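/- **Setting.** Two risk-neutral players compete for a prize $v>0$ in a sequence of battles. In a battle with efforts $x,y\ge 0$ (effort is its own cost) the first player wins with probability $\gamma(x/y)$ if $y>0$, with probability $1$ if $x>y=0$, and with probability $1/2$ if $x=y=0$. Here $\gamma:[0,+\infty]\to[0,1]$ is continuous, twice differentiable on $(0,+\infty)$, with $\gamma(0)=0$, $\gamma(+\infty)=1$, $\gamma'>0$, $\gamma''\le 0$ and $\gamma(r)+\gamma(1/r)=1$ for $r>0$. A contest is described by states; from each non-terminal state either a battle is fought or nature makes a random move, and the outcome determines the next state; at a terminal state one player has won and receives the prize. If play never ends each player receives half of the prize. An *equilibrium* is a symmetric Markov perfect equilibrium in pure strategies: efforts depend on the current state only, no player can gain in any subgame by any (also history-dependent) deviation, and at states that are mirror images of each other (identical up to exchanging the names of the players) the players exchange their efforts. $V_\ell(h)$ denotes the continuation value of player $\ell\in\{A,B\}$ after history $h$. **Subcontest.** A subcontest $\mathcal M$ is played between an incumbent and a challenger; it consists of battles only, has finitely many states, and from every state that can be reached a terminal state can still be reached. Given $\epsilon>0$, it is *sufficiently biased* if in every equilibrium of the standalone contest with the rules of $\mathcal M$ and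 prize $1$ the payoffs $V_+$ of the incumbent and $V_-$ of the challenger satisfy $\frac{1-V_+}{V_-}>\frac1\epsilon$. **Iterated incumbency contest.** A fair coin toss determines the first incumbent. In each of $N$ rounds, with probability $q\in(0,1]$ the subcontest $\mathcal M$ is played and its winner becomes the incumbent; with probability $1-q$ the incumbent keeps his status without a battle. The player who is the incumbent after round $N$ wins the prize $v$. **Transient dominance.** An equilibrium of a contest with prize $v$ has the transient dominance property (with tolerance $\epsilon$) if there are sets $H_A^-$, $H_B^-$ of non-terminal histories such that $V_\ell(h)\le\epsilon v$ for all $h\in H_\ell^-$, $\ell\in\{A,B\}$, and in equilibrium the realized history visits both $H_A^-$ and $H_B^-$ with probability at least $1-\epsilon$. **Theorem (Full dissipation in iterated incumbency contests).** (1) Let $\epsilon>0$, $q\in(0,1]$, and let $\mathcal M$ be a sufficiently biased subcontest (for this $\epsilon$). Then there is $N_0$ such that for all $N\ge N_0$ and all $v>0$, every equilibrium of the $N$-round iterated incumbency contest with subcontest $\mathcal M$ and prize $v$ has the transient dominance property with tolerance $\epsilon$, and its expected total effort is greater than $(1-4\epsilon)v$. (2) For every $\epsilon>0$ there is $K_0$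 such that for all $K\ge K_0$ the following are subcontests as in (1), i.e. they can always still end and are sufficiently biased for $\epsilon$: the contest $\mathcal M(K,1)$, in which the incumbent wins as soon as he wins one battle and the challenger wins if he wins $K$ battles before that; and the tug-of-war with margin $K+1$ in which the incumbent starts with a lead of $K$. Hence rent dissipates almost fully in the limit: the share of the prize that is not dissipated is less than $4\epsilon$, and $\epsilon$ can be chosen arbitrarily small as the bias of the subcontest increases. -/

import Mathlib

open Filter Topology
open scoped NNReal ENNReal

/-- The homogeneous (degree zero) battle technology: a player whose effort is `r` times the
opponent's wins the battle with probability `γ r`. -/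
structure IsSuccessFunction (γ : ℝ → ℝ) : Prop where
  continuousOn : ContinuousOn γ (Set.Ici 0)
  map_zero : γ 0 = 0
  tendsto_one : Tendsto γ atTop (𝓝 1)
  differentiableOn : DifferentiableOn ℝ γ (Set.Ioi 0)
  differentiableOn_deriv : DifferentiableOn ℝ (deriv γ) (Set.Ioi 0)
  deriv_pos : ∀ r : ℝ, 0 < r → 0 < deriv γ r
  deriv_deriv_nonpos : ∀ r : ℝ, 0 < r → deriv (deriv γ) r ≤ 0
  add_inv : ∀ r : ℝ, 0 < r → γ r + γ (1 / r) = 1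

/-- Probability of winning a battle with effort `x` against effort `y`; at `y = 0 < x` this is
`γ (+∞) = 1`, and at `x = y = 0` it is `1 / 2` by symmetry. -/
noncomputable def battleProb (γ : ℝ → ℝ) (x y : ℝ≥0) : ℝ :=
  if y = 0 then (if x = 0 then 1 / 2 else 1) else γ ((x : ℝ) / (y : ℝ))

/-- The two players: `true` is player `A`, `false` is player `B`; the opponent of `ℓ` is `!ℓ`. -/
abbrev Player : Type := Bool

/-- What happens at a state of a contest: it is over and `ℓ` has won; or a battle is fought and
the state moves to `next ℓ` if `ℓ` wins it; or nature moves to `next true` with probability `q`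
and to `next false` with probability `1 - q`. -/
inductive Stage (S : Type*) where
  | won (ℓ : Player) : Stage S
  | battle (next : Player → S) : Stage S
  | chance (q : ℝ) (next : Bool → S) : Stage S

/-- A dynamic contest between `A` and `B`, presented by a state machine. -/
structure Contest (S : Type*) where
  init : S
  stage : S → Stage S

/-- A (pure) Markov strategy profile: the effort of each player at each state. -/
abbrev MarkovProfile (S : Type*) : Type _ := Player → S → ℝ≥0

/-- A general (pure) strategy profile of a subgame: the effort of each player after each history.
A history is the list of the moves so far, the first move first: at a battle the move is the
winner of the battle, at a chance stage it is the branch that nature takes. -/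
abbrev Profile : Type := Player → List Bool → ℝ≥0

namespace Contest

variable {S : Type*} (G : Contest S)

/-- The state after the move `b` (a finished contest stays where it is). -/
def step (s : S) (b : Bool) : S :=
  match G.stage s with
  | .won _ => s
  | .battle next => next b
  | .chance _ next => next b

/-- The state after the history `h`, starting from `s`. -/
def run (s : S) (h : List Bool) : S := h.foldl G.step s

/-- The strategy profile that a Markov profile induces in the subgame that starts at `s`. -/
def induced (σ : MarkovProfile S) (s : S) : Profile := fun ℓ h => σ ℓ (G.run s h)

/-- The probability of the move `b` at state `s` when the players exert the efforts `x`. -/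
noncomputable def moveProb (γ : ℝ → ℝ) (s : S) (x : Player → ℝ≥0) (b : Bool) : ℝ≥0∞ :=
  match G.stage s with
  | .won _ => 0
  | .battle _ => ENNReal.ofReal (battleProb γ (x b) (x (!b)))
  | .chance q _ => ENNReal.ofReal (if b then q else 1 - q)

/-- The probability that play from `s` under `τ` begins with the history `h`. -/
noncomputable def pathProb (γ : ℝ → ℝ) : S → Profile → List Bool → ℝ≥0∞
  | _, _, [] => 1
  | s, τ, b :: h =>
      G.moveProb γ s (fun ℓ => τ ℓ []) b *
        pathProb γ (G.step s b) (fun ℓ g => τ ℓ (b :: g)) h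

open Classical in
/-- The probability that `ℓ` wins the contest, when it is played from `s` under `τ`. -/
noncomputable def victoryProb (γ : ℝ → ℝ) (ℓ : Player) (s : S) (τ : Profile) : ℝ≥0∞ :=
  ∑' h : List Bool, if G.stage (G.run s h) = .won ℓ then G.pathProb γ s τ h else 0

open Classical in
/-- The expected total effort of `ℓ`, when the contest is played from `s` under `τ`. -/
noncomputable def effort (γ : ℝ → ℝ) (ℓ : Player) (s : S) (τ : Profile) : ℝ≥0∞ :=
  ∑' h : List Bool,
    if ∃ next, G.stage (G.run s h) = .battle next then G.pathProb γ s τ h * (τ ℓ h : ℝ≥0∞) else 0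

/-- The expected prize money of `ℓ`: the winner gets `v`, and both get `v / 2` if play never
ends. -/
noncomputable def prizeMoney (γ : ℝ → ℝ) (v : ℝ) (ℓ : Player) (s : S) (τ : Profile) : ℝ≥0∞ :=
  ENNReal.ofReal v * G.victoryProb γ ℓ s τ +
    ENNReal.ofReal (v / 2) * (1 - (G.victoryProb γ true s τ + G.victoryProb γ false s τ))

/-- The expected payoff of `ℓ` (it is `-∞` for a strategy of infinite expected cost). -/
noncomputable def payoff (γ : ℝ → ℝ) (v : ℝ) (ℓ : Player) (s : S) (τ : Profile) : EReal :=
  (G.prizeMoney γ v ℓ s τ : EReal) - (G.effort γ ℓ s τ : EReal)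

/-- The continuation value of `ℓ` at state `s` under the Markov profile `σ`. -/
noncomputable def value (γ : ℝ → ℝ) (v : ℝ) (σ : MarkovProfile S) (ℓ : Player) (s : S) : EReal :=
  G.payoff γ v ℓ s (G.induced σ s)

/-- Markov perfect equilibrium: after no history can a player gain by any unilateral deviation,
history-dependent deviations included. -/
def IsMPE (γ : ℝ → ℝ) (v : ℝ) (σ : MarkovProfile S) : Prop :=
  ∀ (h : List Bool) (ℓ : Player) (τ : List Bool → ℝ≥0),
    G.payoff γ v ℓ (G.run G.init h) (Function.update (G.induced σ (G.run G.init h)) ℓ τ) ≤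
      G.value γ v σ ℓ (G.run G.init h)

/-- `R` relates only states that are mirror images: the contest that follows the one is the
contest that follows the other with the names of the players exchanged. -/
def IsMirror (R : S → S → Prop) : Prop :=
  ∀ s s', R s s' →
    match G.stage s, G.stage s' with
    | .won ℓ, .won ℓ' => ℓ' = !ℓ
    | .battle next, .battle next' => ∀ b, R (next b) (next' (!b))
    | .chance q next, .chance q' next' => q' = q ∧ ∀ b, R (next b) (next' b)
    | _, _ => False

/-- A Markov profile is symmetric if efforts do not depend on the names of the players: at states
that are mirror images of each other the players exchange their efforts. -/
def IsSymmetric (σ : MarkovProfile S) : Prop :=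
  ∀ R : S → S → Prop, G.IsMirror R → ∀ s s', R s s' →
    (∃ next, G.stage s = .battle next) → ∀ ℓ, σ ℓ s = σ (!ℓ) s'

/-- Symmetric Markov perfect equilibrium of the contest with prize `v`. -/
def IsEquilibrium (γ : ℝ → ℝ) (v : ℝ) (σ : MarkovProfile S) : Prop :=
  G.IsMPE γ v σ ∧ G.IsSymmetric σ

/-- Along the history `h` both sets `H true` and `H false` have been visited. -/
def VisitedBoth (H : Player → Set (List Bool)) (h : List Bool) : Prop :=
  ∀ ℓ, ∃ g, g <+: h ∧ g ∈ H ℓ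

open Classical in
/-- The probability that the realized history visits both `H true` and `H false`: the sum of the
probabilities of the histories at which this happens for the first time. -/
noncomputable def visitBothProb (γ : ℝ → ℝ) (σ : MarkovProfile S) (H : Player → Set (List Bool)) :
    ℝ≥0∞ :=
  ∑' h : List Bool,
    if VisitedBoth H h ∧ ∀ g, g <+: h → g ≠ h → ¬ VisitedBoth H g then
      G.pathProb γ G.init (G.induced σ G.init) h
    else 0

/-- The transient dominance property, with tolerance `ε`, of the profile `σ` in the contest with
prize `v`. -/
def TransientDominance (γ : ℝ → ℝ) (v : ℝ) (σ : MarkovProfile S) (ε : ℝ) : Prop :=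
  ∃ H : Player → Set (List Bool),
    (∀ ℓ, ∀ h ∈ H ℓ, (∀ k, G.stage (G.run G.init h) ≠ .won k) ∧
      G.value γ v σ ℓ (G.run G.init h) ≤ ((ε * v : ℝ) : EReal)) ∧
    ENNReal.ofReal (1 - ε) ≤ G.visitBothProb γ σ H

/-- The expected total effort of both players in the contest. -/
noncomputable def totalEffort (γ : ℝ → ℝ) (σ : MarkovProfile S) : ℝ≥0∞ :=
  G.effort γ true G.init (G.induced σ G.init) + G.effort γ false G.init (G.induced σ G.init)

end Contest

/-- A subcontest between an incumbent (role `true`) and a challenger (role `false`), presented by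
a state machine: `winner s` is the role that has won, if `s` is terminal, and otherwise `next s w`
is the state after a battle won by the role `w`. -/
structure Subcontest (S : Type*) where
  init : S
  winner : S → Option Bool
  next : S → Bool → S

namespace Subcontest

variable {S : Type*} (M : Subcontest S)

/-- The standalone contest with the rules of the subcontest; the incumbent is player `true`. -/
def standalone : Contest S where
  init := M.init
  stage s := match M.winner s with
    | some w => .won w
    | none => .battle (M.next s)

/-- Whatever has happened, the subcontest can still come to an end. -/
def CanAlwaysEnd : Prop :=
  ∀ h : List Bool, ∃ g : List Bool,
    M.winner (M.standalone.run M.init (h ++ g)) ≠ none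

/-- Sufficient bias in favor of the incumbent, with tolerance `ε`: `(1 - V₊) / V₋ > 1 / ε` for the
equilibrium payoffs of incumbent and challenger in the standalone contest with a unit prize. -/
def SufficientlyBiased (γ : ℝ → ℝ) (ε : ℝ) : Prop :=
  ∀ σ : MarkovProfile S, M.standalone.IsEquilibrium γ 1 σ →
    (1 - (M.standalone.value γ 1 σ true M.init).toReal) /
      (M.standalone.value γ 1 σ false M.init).toReal > 1 / ε

end Subcontest

/-- The states of an iterated incumbency contest: the initial coin toss; the beginning of round `n`
with incumbent `i`; the state `s` of the subcontest in round `n` with incumbent `i`. -/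
inductive IterState (S : Type*) where
  | toss : IterState S
  | round (n : ℕ) (i : Player) : IterState S
  | fight (n : ℕ) (i : Player) (s : S) : IterState S

namespace Subcontest

variable {S : Type*} (M : Subcontest S)

/-- The subcontest of round `n` with incumbent `i` arrives at `s`: it goes on, or the player who
has won it enters round `n + 1` as the incumbent. The player in the role `w` is `w == i`, that is,
`i` for `w = true` and `!i` for `w = false`. -/
def arrive (n : ℕ) (i : Player) (s : S) : IterState S :=
  match M.winner s with
  | none => .fight n i s
  | some w => .round (n + 1) (w == i)

/-- The `N`-round iterated incumbency contest. A fair coin toss determines the incumbent. In each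
round `1, …, N` the subcontest is played with probability `q`, and otherwise the incumbent keeps
his status. The player who leaves round `N` as the incumbent wins the prize. -/
noncomputable def iterated (q : ℝ) (N : ℕ) : Contest (IterState S) where
  init := .toss
  stage
    | .toss => .chance (1 / 2) (fun i => .round 1 i)
    | .round n i =>
        if n ≤ N then
          .chance q (fun b => if b then M.arrive n i M.init else .round (n + 1) i)
        else .won i
    | .fight n i s => .battle (fun ℓ => M.arrive n i (M.next s (ℓ == i)))

end Subcontest

/-- The subcontest in which the incumbent needs one battle win and the challenger `K` wins before
that. State `some j`: the challenger still needs `j` wins; state `none`: the incumbent has won. -/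
def oneWinRace (K : ℕ) : Subcontest (Option (Fin (K + 1))) where
  init := some (Fin.last K)
  winner
    | none => some true
    | some j => if j.val = 0 then some false else none
  next s w := match s with
    | none => none
    | some j => if w then none else some ⟨j.val - 1, by omega⟩

/-- The tug-of-war with margin `K + 1` in which the incumbent starts with a lead of `K`. The state
`j` means that the lead of the incumbent is `j - (K + 1)`. -/
def headStartTugOfWar (K : ℕ) : Subcontest (Fin (2 * K + 3)) where
  init := ⟨2 * K + 1, by omega⟩
  winner j := if j.val = 2 * K + 2 then some true else if j.val = 0 then some false else none
  next j w := if w then ⟨min (j.val + 1) (2 * K + 2), by omega⟩ else ⟨j.val - 1, by omega⟩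

/-!
Why full dissipation holds. In an equilibrium, every battle that can be reached is of one of two
kinds (`battleValues_of_optimal`). Either no player wants to win it, both are idle and a fair coin
decides; or both want to win it, and a player whose prize is `r` times the opponent's gets the value
of a defeat and the rent `rent γ r = γ r - r * γ' r` per unit of his prize. Everything else follows
from these recursions for the values, together with the fact that all moves have positive
probability, so that maximum principles hold (`Subcontest.CanAlwaysEnd.le_of_terminal_le`).

*Iterated contests.* Let `V₊` and `V₋` be the values of the incumbent and of the challenger at the
beginning of a round, and `V₊'` and `V₋'` those at the beginning of the next round. The players fight
for the prize `V₊' - V₋'`, and as long as it is positive they play, up to scale, an equilibrium of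
the standalone subcontest (`Subcontest.exists_standalone_equilibrium`). Sufficient bias therefore
carries over from round to round, and `V₋ ≤ ε * (v - V₊)` in all rounds. Backwards through the
rounds, `V₊ - V₋` shrinks by a factor which is bounded away from `1`, unless it ceases to be positive
(`Subcontest.round_values`). In either case both players end up with a value of at most `ε * v`, up
to a small error which the inequality absorbs, and their joint value cannot rise from a round to the
preceding one. So `V₊ + V₋ ≤ 2 * ε * v` in the first round. Both players have a value of at most
`ε * v` already before the coin toss, which gives transient dominance, and the total effort is at
least `v - 2 * ε * v`.

*The uniform factor.* The subcontest may have many equilibria, so that one needs a bound on the loss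
`1 - V₊` of the incumbent which is uniform over all of them (`Subcontest.exists_loss_bound`). If
rents are always positive, then a challenger whose value is small has small values at all states
that can be reached, which is impossible at the states where he has won. Otherwise `γ` is linear
near `0`, and a much weaker player gets no rent. Then consider the states where the loss of the
incumbent is small, and among these the ones where the value of the challenger is maximal. At each
of them the player with the larger prize can be followed to another such state, and his victory
increases the joint value (`BattleValues.surplus_lt_of_favorite`); on a finite set of states this
cannot go on.

*Examples.* In the race, and in a symmetric equilibrium of the tug-of-war, the ratio of the prizes
grows from battle to battle by at least the factor `(1 - rent γ r) / rent γ (1 / r) > 1`, which is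
bounded away from `1` for bounded `r` (`IsSuccessFunction.exists_ratio_bound`).
-/

/-! ### Expected rewards along the play of a contest -/

/-- A sum over histories splits according to the first move. -/
theorem tsum_list_bool (f : List Bool → ℝ≥0∞) :
    ∑' h, f h = f [] + ∑ b : Bool, ∑' h, f (b :: h) := by
  classical
  rw [ENNReal.tsum_eq_add_tsum_ite []]
  congr 1
  have hinj : Function.Injective (fun p : Bool × List Bool => p.1 :: p.2) := by
    rintro ⟨a, l⟩ ⟨b, k⟩ h
    simpa using h
  rw [← hinj.tsum_eq, ← tsum_fintype (L := .unconditional _),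
    ← ENNReal.tsum_prod (f := fun b h => f (b :: h))]
  · simp only [reduceCtorEq, if_false]
  · intro h hh
    cases h with
    | nil => simp at hh
    | cons b h => exact ⟨(b, h), rfl⟩

/-- The strategy profile that is left of `τ` after the move `b`. -/
def Profile.tail (τ : Profile) (b : Bool) : Profile := fun ℓ g => τ ℓ (b :: g)

namespace Contest

variable {S : Type*} (G : Contest S) (γ : ℝ → ℝ)

theorem run_nil (s : S) : G.run s [] = s := rfl

theorem run_cons (s : S) (b : Bool) (h : List Bool) :
    G.run s (b :: h) = G.run (G.step s b) h := rfl

theorem run_append (s : S) (h g : List Bool) : G.run s (h ++ g) = G.run (G.run s h) g := by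
  simp [run]

theorem step_of_won {s : S} {ℓ : Player} (hs : G.stage s = .won ℓ) (b : Bool) :
    G.step s b = s := by
  simp [step, hs]

theorem step_of_battle {s : S} {next : Player → S} (hs : G.stage s = .battle next) (b : Bool) :
    G.step s b = next b := by
  simp [step, hs]

theorem step_of_chance {s : S} {q : ℝ} {next : Bool → S} (hs : G.stage s = .chance q next)
    (b : Bool) : G.step s b = next b := by
  simp [step, hs]

theorem moveProb_of_won {s : S} {ℓ : Player} (hs : G.stage s = .won ℓ) (x : Player → ℝ≥0)
    (b : Bool) : G.moveProb γ s x b = 0 := by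
  simp [moveProb, hs]

theorem moveProb_of_battle {s : S} {next : Player → S} (hs : G.stage s = .battle next)
    (x : Player → ℝ≥0) (b : Bool) :
    G.moveProb γ s x b = ENNReal.ofReal (battleProb γ (x b) (x (!b))) := by
  simp [moveProb, hs]

theorem moveProb_of_chance {s : S} {q : ℝ} {next : Bool → S} (hs : G.stage s = .chance q next)
    (x : Player → ℝ≥0) (b : Bool) :
    G.moveProb γ s x b = ENNReal.ofReal (if b then q else 1 - q) := by
  simp [moveProb, hs]

/-- The expected value of the sum over all histories `h` that occur of a reward `c` that depends
on the state after `h` and on the efforts after `h`. -/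
noncomputable def expReward (c : S → (Player → ℝ≥0) → ℝ≥0∞) (s : S) (τ : Profile) : ℝ≥0∞ :=
  ∑' h : List Bool, G.pathProb γ s τ h * c (G.run s h) (fun ℓ => τ ℓ h)

/-- The part of the expected reward that is collected after fewer than `n` moves. -/
noncomputable def rewardUpTo (c : S → (Player → ℝ≥0) → ℝ≥0∞) : ℕ → S → Profile → ℝ≥0∞
  | 0, _, _ => 0
  | n + 1, s, τ => c s (fun ℓ => τ ℓ []) +
      ∑ b : Bool, G.moveProb γ s (fun ℓ => τ ℓ []) b * rewardUpTo c n (G.step s b) (τ.tail b)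

variable (c : S → (Player → ℝ≥0) → ℝ≥0∞)

theorem expReward_eq (s : S) (τ : Profile) :
    G.expReward γ c s τ = c s (fun ℓ => τ ℓ []) +
      ∑ b : Bool, G.moveProb γ s (fun ℓ => τ ℓ []) b *
        G.expReward γ c (G.step s b) (τ.tail b) := by
  simp only [expReward]
  rw [tsum_list_bool]
  simp only [pathProb, run_nil, one_mul, run_cons, mul_assoc, ENNReal.tsum_mul_left]
  rfl

theorem rewardUpTo_eq_tsum (n : ℕ) (s : S) (τ : Profile) :
    G.rewardUpTo γ c n s τ = ∑' h : List Bool,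
      if h.length < n then G.pathProb γ s τ h * c (G.run s h) (fun ℓ => τ ℓ h) else 0 := by
  induction n generalizing s τ with
  | zero => simp [rewardUpTo]
  | succ n ih =>
    rw [rewardUpTo, tsum_list_bool]
    simp only [ih, ← ENNReal.tsum_mul_left]
    simp [pathProb, run_nil, run_cons, mul_assoc]
    rfl

theorem rewardUpTo_le (n : ℕ) (s : S) (τ : Profile) :
    G.rewardUpTo γ c n s τ ≤ G.expReward γ c s τ := by
  rw [rewardUpTo_eq_tsum, expReward]
  refine ENNReal.tsum_le_tsum fun h => ?_
  split_ifs <;> simp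

theorem expReward_le_of_rewardUpTo_le {s : S} {τ : Profile} {X : ℝ≥0∞}
    (hX : ∀ n, G.rewardUpTo γ c n s τ ≤ X) : G.expReward γ c s τ ≤ X := by
  rw [expReward, ENNReal.tsum_eq_iSup_sum]
  refine iSup_le fun F => ?_
  refine le_trans ?_ (hX (F.sup List.length + 1))
  rw [rewardUpTo_eq_tsum]
  refine le_trans (le_of_eq ?_) (ENNReal.sum_le_tsum F)
  refine Finset.sum_congr rfl fun h hh => ?_
  rw [if_pos (Nat.lt_succ_of_le (Finset.le_sup (f := List.length) hh))]

theorem expReward_of_won {s : S} {ℓ : Player} (hs : G.stage s = .won ℓ) (τ : Profile) :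
    G.expReward γ c s τ = c s (fun ℓ => τ ℓ []) := by
  rw [expReward_eq]
  simp [G.moveProb_of_won γ hs]

open Classical in
/-- The reward `1` for a victory of `ℓ`. -/
noncomputable def winReward (ℓ : Player) (s : S) (_ : Player → ℝ≥0) : ℝ≥0∞ :=
  if G.stage s = .won ℓ then 1 else 0

open Classical in
/-- The effort of `ℓ` in the battles. -/
noncomputable def effortReward (ℓ : Player) (s : S) (x : Player → ℝ≥0) : ℝ≥0∞ :=
  if ∃ next, G.stage s = .battle next then (x ℓ : ℝ≥0∞) else 0

theorem victoryProb_eq_expReward (ℓ : Player) (s : S) (τ : Profile) :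
    G.victoryProb γ ℓ s τ = G.expReward γ (G.winReward ℓ) s τ := by
  simp [victoryProb, expReward, winReward]

theorem effort_eq_expReward (ℓ : Player) (s : S) (τ : Profile) :
    G.effort γ ℓ s τ = G.expReward γ (G.effortReward ℓ) s τ := by
  simp [effort, expReward, effortReward]

theorem winReward_of_won {s : S} {w : Player} (hs : G.stage s = .won w) (ℓ : Player)
    (x : Player → ℝ≥0) : G.winReward ℓ s x = if w = ℓ then 1 else 0 := by
  simp [winReward, hs]

theorem winReward_of_battle {s : S} {next : Player → S} (hs : G.stage s = .battle next)
    (ℓ : Player) (x : Player → ℝ≥0) : G.winReward ℓ s x = 0 := by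
  simp [winReward, hs]

theorem winReward_of_chance {s : S} {q : ℝ} {next : Bool → S} (hs : G.stage s = .chance q next)
    (ℓ : Player) (x : Player → ℝ≥0) : G.winReward ℓ s x = 0 := by
  simp [winReward, hs]

theorem effortReward_of_won {s : S} {w : Player} (hs : G.stage s = .won w) (ℓ : Player)
    (x : Player → ℝ≥0) : G.effortReward ℓ s x = 0 := by
  simp [effortReward, hs]

theorem effortReward_of_battle {s : S} {next : Player → S} (hs : G.stage s = .battle next)
    (ℓ : Player) (x : Player → ℝ≥0) : G.effortReward ℓ s x = x ℓ := by
  simp [effortReward, hs]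

theorem effortReward_of_chance {s : S} {q : ℝ} {next : Bool → S}
    (hs : G.stage s = .chance q next) (ℓ : Player) (x : Player → ℝ≥0) :
    G.effortReward ℓ s x = 0 := by
  simp [effortReward, hs]

theorem induced_nil (σ : MarkovProfile S) (s : S) (ℓ : Player) : G.induced σ s ℓ [] = σ ℓ s := rfl

theorem induced_tail (σ : MarkovProfile S) (s : S) (b : Bool) :
    (G.induced σ s).tail b = G.induced σ (G.step s b) := rfl

end Contest

/-! ### The battle technology -/

/-- The equilibrium rent, per unit of his prize, of a player whose prize is `r` times the prize of
the opponent: he wins with probability `γ r` and bids the fraction `r * γ' r` of his prize. -/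
noncomputable def rent (γ : ℝ → ℝ) (r : ℝ) : ℝ := γ r - r * deriv γ r

namespace IsSuccessFunction

variable {γ : ℝ → ℝ}

theorem differentiableAt (hγ : IsSuccessFunction γ) {r : ℝ} (hr : 0 < r) :
    DifferentiableAt ℝ γ r :=
  (hγ.differentiableOn r hr).differentiableAt (Ioi_mem_nhds hr)

theorem concaveOn (hγ : IsSuccessFunction γ) : ConcaveOn ℝ (Set.Ici 0) γ := by
  refine concaveOn_of_deriv2_nonpos (convex_Ici 0) hγ.continuousOn ?_ ?_ ?_
  · simpa using hγ.differentiableOn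
  · simpa using hγ.differentiableOn_deriv
  · intro x hx
    rw [interior_Ici] at hx
    simpa using hγ.deriv_deriv_nonpos x hx

theorem strictMonoOn (hγ : IsSuccessFunction γ) : StrictMonoOn γ (Set.Ici 0) := by
  refine strictMonoOn_of_deriv_pos (convex_Ici 0) hγ.continuousOn fun x hx => ?_
  rw [interior_Ici] at hx
  exact hγ.deriv_pos x hx

theorem antitoneOn_deriv (hγ : IsSuccessFunction γ) : AntitoneOn (deriv γ) (Set.Ioi 0) := by
  refine antitoneOn_of_deriv_nonpos (convex_Ioi 0) hγ.differentiableOn_deriv.continuousOn ?_ ?_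
  · simpa using hγ.differentiableOn_deriv
  · intro x hx
    rw [interior_Ioi] at hx
    exact hγ.deriv_deriv_nonpos x hx

theorem pos (hγ : IsSuccessFunction γ) {r : ℝ} (hr : 0 < r) : 0 < γ r := by
  have := hγ.strictMonoOn (Set.mem_Ici.2 le_rfl) (Set.mem_Ici.2 hr.le) hr
  rwa [hγ.map_zero] at this

theorem add_inv' (hγ : IsSuccessFunction γ) {r : ℝ} (hr : 0 < r) : γ r + γ r⁻¹ = 1 := by
  rw [← one_div]
  exact hγ.add_inv r hr

theorem lt_one (hγ : IsSuccessFunction γ) {r : ℝ} (hr : 0 < r) : γ r < 1 := by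
  have h1 := hγ.add_inv' hr
  have h2 := hγ.pos (inv_pos.2 hr)
  linarith

theorem nonneg (hγ : IsSuccessFunction γ) {r : ℝ} (hr : 0 ≤ r) : 0 ≤ γ r := by
  rcases hr.eq_or_lt with rfl | h
  · rw [hγ.map_zero]
  · exact (hγ.pos h).le

theorem le_one (hγ : IsSuccessFunction γ) {r : ℝ} (hr : 0 ≤ r) : γ r ≤ 1 := by
  rcases hr.eq_or_lt with rfl | h
  · rw [hγ.map_zero]
    exact zero_le_one
  · exact (hγ.lt_one h).le

/-- The graph of `γ` lies below its tangents. -/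
theorem le_tangent (hγ : IsSuccessFunction γ) {a b : ℝ} (ha : 0 ≤ a) (hb : 0 < b) :
    γ a ≤ γ b + deriv γ b * (a - b) := by
  rcases lt_trichotomy a b with h | rfl | h
  · have := hγ.concaveOn.deriv_le_slope (Set.mem_Ici.2 ha) (Set.mem_Ici.2 hb.le) h
      (hγ.differentiableAt hb)
    rw [slope_def_field, le_div_iff₀ (by linarith)] at this
    linarith
  · simp
  · have := hγ.concaveOn.slope_le_deriv (Set.mem_Ici.2 hb.le) (Set.mem_Ici.2 ha) h
      (hγ.differentiableAt hb)
    rw [slope_def_field, div_le_iff₀ (by linarith)] at this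
    linarith

/-- The marginal effects of the two players' efforts mirror each other. -/
theorem inv_mul_deriv_inv (hγ : IsSuccessFunction γ) {r : ℝ} (hr : 0 < r) :
    r⁻¹ * deriv γ r⁻¹ = r * deriv γ r := by
  have h1 : HasDerivAt (fun x : ℝ => γ x + γ x⁻¹)
      (deriv γ r + deriv γ r⁻¹ * (-(r ^ 2)⁻¹)) r := by
    refine (hγ.differentiableAt hr).hasDerivAt.add ?_
    exact (hγ.differentiableAt (inv_pos.2 hr)).hasDerivAt.comp r (hasDerivAt_inv hr.ne')
  have h2 : HasDerivAt (fun x : ℝ => γ x + γ x⁻¹) 0 r := by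
    refine (hasDerivAt_const r (1 : ℝ)).congr_of_eventuallyEq ?_
    filter_upwards [Ioi_mem_nhds hr] with x hx using hγ.add_inv' hx
  have h3 := h1.unique h2
  field_simp at h3 ⊢
  linarith

theorem rent_nonneg (hγ : IsSuccessFunction γ) {r : ℝ} (hr : 0 < r) : 0 ≤ rent γ r := by
  have := hγ.le_tangent le_rfl hr
  rw [hγ.map_zero] at this
  unfold rent
  linarith

theorem rent_mono (hγ : IsSuccessFunction γ) {r s : ℝ} (hr : 0 < r) (hrs : r ≤ s) :
    rent γ r ≤ rent γ s := by
  have hs : 0 < s := hr.trans_le hrs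
  have h1 := hγ.le_tangent hr.le hs
  have h2 := mul_le_mul_of_nonneg_left (hγ.antitoneOn_deriv hr hs hrs) hr.le
  unfold rent
  linarith

theorem bid_pos (hγ : IsSuccessFunction γ) {r : ℝ} (hr : 0 < r) : 0 < r * deriv γ r :=
  mul_pos hr (hγ.deriv_pos r hr)

theorem rent_lt (hγ : IsSuccessFunction γ) {r : ℝ} (hr : 0 < r) : rent γ r < γ r := by
  have := hγ.bid_pos hr
  unfold rent
  linarith

theorem rent_lt_one (hγ : IsSuccessFunction γ) {r : ℝ} (hr : 0 < r) : rent γ r < 1 :=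
  (hγ.rent_lt hr).trans (hγ.lt_one hr)

theorem rent_inv (hγ : IsSuccessFunction γ) {r : ℝ} (hr : 0 < r) :
    rent γ r⁻¹ = γ r⁻¹ - r * deriv γ r := by
  rw [rent, hγ.inv_mul_deriv_inv hr]

theorem one_sub_rent (hγ : IsSuccessFunction γ) {r : ℝ} (hr : 0 < r) :
    1 - rent γ r = γ r⁻¹ + r * deriv γ r := by
  have := hγ.add_inv' hr
  unfold rent
  linarith

end IsSuccessFunction

section BattleProb

variable {γ : ℝ → ℝ}

theorem battleProb_nonneg (hγ : IsSuccessFunction γ) (x y : ℝ≥0) : 0 ≤ battleProb γ x y := by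
  unfold battleProb
  split_ifs
  · norm_num
  · norm_num
  · exact hγ.nonneg (by positivity)

theorem battleProb_add (hγ : IsSuccessFunction γ) (x y : ℝ≥0) :
    battleProb γ x y + battleProb γ y x = 1 := by
  unfold battleProb
  by_cases hx : x = 0 <;> by_cases hy : y = 0 <;> simp only [hx, hy, if_true, if_false]
  · norm_num
  · simp [hγ.map_zero]
  · simp [hγ.map_zero]
  · have hx' : 0 < (x : ℝ) := by positivity
    have hy' : 0 < (y : ℝ) := by positivity
    have := hγ.add_inv' (div_pos hx' hy')
    rwa [inv_div] at this

theorem battleProb_mul_mul (γ : ℝ → ℝ) {k : ℝ≥0} (hk : k ≠ 0) (x y : ℝ≥0) :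
    battleProb γ (k * x) (k * y) = battleProb γ x y := by
  have hk' : (k : ℝ) ≠ 0 := by exact_mod_cast hk
  simp [battleProb, hk, mul_div_mul_left _ _ hk']

theorem battleProb_of_pos (γ : ℝ → ℝ) (x : ℝ≥0) {y : ℝ≥0} (hy : y ≠ 0) :
    battleProb γ x y = γ (x / y) := by
  simp [battleProb, hy]

end BattleProb

/-- The equilibrium values `V` of a battle when `a ℓ b` is the continuation value of `ℓ` after a
victory of `b`. Either no player wants to win, both stay idle and a fair coin decides; or both
players want to win, and each of them gets the value of a defeat and the rent on his prize. -/
def BattleValues (γ : ℝ → ℝ) (a : Player → Player → ℝ) (V : Player → ℝ) : Prop :=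
  (∀ ℓ, a ℓ ℓ ≤ a ℓ (!ℓ) ∧ V ℓ = (a ℓ ℓ + a ℓ (!ℓ)) / 2) ∨
  (∀ ℓ, a ℓ (!ℓ) < a ℓ ℓ ∧
    V ℓ = a ℓ (!ℓ) +
      (a ℓ ℓ - a ℓ (!ℓ)) * rent γ ((a ℓ ℓ - a ℓ (!ℓ)) / (a (!ℓ) (!ℓ) - a (!ℓ) ℓ)))

/-- A positive best response to a positive effort satisfies the first-order condition. -/
theorem best_response {γ : ℝ → ℝ} (hγ : IsSuccessFunction γ) {x y : ℝ≥0} (hx : x ≠ 0)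
    (hy : y ≠ 0) {z : ℝ}
    (hopt : ∀ x' : ℝ≥0, battleProb γ x' y * z - x' ≤ battleProb γ x y * z - x) :
    0 < z ∧ deriv γ (x / y) * z = y := by
  have hx' : 0 < (x : ℝ) := by positivity
  have hy' : 0 < (y : ℝ) := by positivity
  have hr : 0 < (x / y : ℝ) := div_pos hx' hy'
  simp only [battleProb_of_pos γ _ hy] at hopt
  constructor
  · have h0 := hopt 0
    simp only [NNReal.coe_zero, zero_div, hγ.map_zero, zero_mul, sub_zero] at h0
    have h1 := hγ.pos hr
    by_contra hz
    nlinarith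
  · have hmax : IsLocalMax (fun t : ℝ => γ (t / y) * z - t) x := by
      filter_upwards [Ioi_mem_nhds hx'] with t ht
      have := hopt t.toNNReal
      simpa [Real.coe_toNNReal t (le_of_lt ht)] using this
    have hd : HasDerivAt (fun t : ℝ => γ (t / y) * z - t)
        (deriv γ (x / y) * (1 / y) * z - 1) x := by
      refine HasDerivAt.sub ?_ (hasDerivAt_id _)
      refine HasDerivAt.mul_const ?_ z
      exact HasDerivAt.comp (x : ℝ) (hγ.differentiableAt hr).hasDerivAt
        ((hasDerivAt_id (x : ℝ)).div_const _)
    have := hmax.hasDerivAt_eq_zero hd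
    field_simp at this
    linarith

/-- If no player can gain by a different effort in a battle, then the values satisfy
`BattleValues`, and either player wins with positive probability. -/
theorem battleValues_of_optimal {γ : ℝ → ℝ} (hγ : IsSuccessFunction γ) {e : Player → ℝ≥0}
    {a : Player → Player → ℝ} {V : Player → ℝ}
    (hV : ∀ ℓ, V ℓ = battleProb γ (e ℓ) (e (!ℓ)) * a ℓ ℓ +
      (1 - battleProb γ (e ℓ) (e (!ℓ))) * a ℓ (!ℓ) - e ℓ)
    (hopt : ∀ ℓ (x : ℝ≥0), battleProb γ x (e (!ℓ)) * a ℓ ℓ +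
      (1 - battleProb γ x (e (!ℓ))) * a ℓ (!ℓ) - x ≤ V ℓ) :
    BattleValues γ a V ∧ ∀ ℓ, 0 < battleProb γ (e ℓ) (e (!ℓ)) := by
  -- Nobody bids against an idle opponent: half of the bid would win as surely.
  have hidle : ∀ ℓ, e ℓ = 0 → e (!ℓ) = 0 := by
    intro ℓ h0
    by_contra hne
    have h1 := hopt (!ℓ) (e (!ℓ) / 2)
    rw [hV (!ℓ), Bool.not_not, h0] at h1
    have h2 : (0 : ℝ) < e (!ℓ) := by positivity
    simp [battleProb, hne] at h1
    linarith
  by_cases h : e true = 0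
  · have h' : e false = 0 := hidle true h
    have he : ∀ ℓ, e ℓ = 0 := by
      rintro (_ | _) <;> assumption
    refine ⟨Or.inl fun ℓ => ?_, fun ℓ => by simp [battleProb, he]⟩
    have hVℓ : V ℓ = (a ℓ ℓ + a ℓ (!ℓ)) / 2 := by
      rw [hV ℓ]
      simp [battleProb, he]
      ring
    refine ⟨?_, hVℓ⟩
    -- An arbitrarily small bid would win for sure.
    have hlim : a ℓ ℓ ≤ V ℓ := by
      refine le_of_forall_pos_le_add fun δ hδ => ?_
      have := hopt ℓ δ.toNNReal
      simp [battleProb, he, Real.coe_toNNReal δ hδ.le, hδ.not_ge] at this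
      linarith
    linarith
  · have h' : e false ≠ 0 := fun h0 => h (hidle false h0)
    have he : ∀ ℓ, e ℓ ≠ 0 := by
      rintro (_ | _) <;> assumption
    have hr : ∀ ℓ, 0 < (e ℓ / e (!ℓ) : ℝ) := fun ℓ => by
      have h1 := he ℓ
      have h2 := he (!ℓ)
      positivity
    have hbr : ∀ ℓ, 0 < a ℓ ℓ - a ℓ (!ℓ) ∧
        deriv γ (e ℓ / e (!ℓ)) * (a ℓ ℓ - a ℓ (!ℓ)) = e (!ℓ) := by
      intro ℓ
      refine best_response hγ (he ℓ) (he (!ℓ)) fun x' => ?_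
      have h1 := hopt ℓ x'
      rw [hV ℓ] at h1
      linarith
    refine ⟨Or.inr fun ℓ => ?_, fun ℓ => ?_⟩
    · have h1 := hbr ℓ
      have h2 := hbr (!ℓ)
      rw [Bool.not_not] at h2
      refine ⟨by linarith [h1.1], ?_⟩
      set z := a ℓ ℓ - a ℓ (!ℓ) with hz
      set z' := a (!ℓ) (!ℓ) - a (!ℓ) ℓ with hz'
      have hx : (0 : ℝ) < e ℓ := by have := he ℓ; positivity
      have hy : (0 : ℝ) < e (!ℓ) := by have := he (!ℓ); positivity
      have hm := hγ.inv_mul_deriv_inv (hr ℓ)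
      rw [inv_div] at hm
      have hd := hγ.deriv_pos _ (hr ℓ)
      set D := deriv γ (e ℓ / e (!ℓ)) with hD
      set D' := deriv γ (e (!ℓ) / e ℓ) with hD'
      -- The ratio of the efforts is the ratio of the prizes.
      have hratio : z / z' = e ℓ / e (!ℓ) := by
        have h3 : D' = (e ℓ / e (!ℓ)) ^ 2 * D := by
          field_simp at hm ⊢
          linarith
        rw [h3] at h2
        rw [div_eq_div_iff h2.1.ne' hy.ne']
        have h4 : D * (z * e (!ℓ)) = D * (e ℓ * z') := by
          have h5 := h2.2
          field_simp at h5
          linear_combination h1.2 * (e (!ℓ) : ℝ) - h5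
        exact mul_left_cancel₀ hd.ne' h4
      rw [hratio, hV ℓ, battleProb_of_pos γ _ (he (!ℓ)), rent, ← hD]
      have h6 : (e ℓ / e (!ℓ) : ℝ) * D * z = e ℓ := by
        rw [mul_assoc, h1.2]
        field_simp
      rw [hz] at h6
      linear_combination h6
    · rw [battleProb_of_pos γ _ (he (!ℓ))]
      exact hγ.pos (hr ℓ)

/-! ### Payoffs as real numbers -/

namespace Contest

variable {S : Type*} {G : Contest S} {γ : ℝ → ℝ}

/-- The random moves of nature are made with genuine probabilities. -/
def ProperChances (G : Contest S) : Prop :=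
  ∀ s q next, G.stage s = .chance q next → 0 ≤ q ∧ q ≤ 1

theorem sum_moveProb (hγ : IsSuccessFunction γ) (hG : G.ProperChances) {s : S}
    (hs : ∀ ℓ, G.stage s ≠ .won ℓ) (x : Player → ℝ≥0) : ∑ b : Bool, G.moveProb γ s x b = 1 := by
  cases h : G.stage s with
  | won ℓ => exact absurd h (hs ℓ)
  | battle next =>
    simp only [G.moveProb_of_battle γ h, Fintype.sum_bool, Bool.not_true, Bool.not_false]
    rw [← ENNReal.ofReal_add (battleProb_nonneg hγ _ _) (battleProb_nonneg hγ _ _),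
      battleProb_add hγ, ENNReal.ofReal_one]
  | chance q next =>
    obtain ⟨h0, h1⟩ := hG s q next h
    simp only [G.moveProb_of_chance γ h, Fintype.sum_bool, if_true, Bool.false_eq_true, if_false]
    rw [← ENNReal.ofReal_add h0 (by linarith)]
    simp

theorem moveProb_ne_top (s : S) (x : Player → ℝ≥0) (b : Bool) : G.moveProb γ s x b ≠ ⊤ := by
  unfold moveProb
  split <;> simp

theorem victoryProb_add_le_one (hγ : IsSuccessFunction γ) (hG : G.ProperChances) (s : S)
    (τ : Profile) (ℓ : Player) : G.victoryProb γ ℓ s τ + G.victoryProb γ (!ℓ) s τ ≤ 1 := by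
  have hadd : G.victoryProb γ ℓ s τ + G.victoryProb γ (!ℓ) s τ =
      G.expReward γ (fun s x => G.winReward ℓ s x + G.winReward (!ℓ) s x) s τ := by
    simp only [victoryProb_eq_expReward, expReward, mul_add, ENNReal.tsum_add]
  rw [hadd]
  refine G.expReward_le_of_rewardUpTo_le γ _ fun n => ?_
  clear hadd
  induction n generalizing s τ with
  | zero => simp [rewardUpTo]
  | succ n ih =>
    rw [rewardUpTo]
    by_cases hw : ∃ w, G.stage s = .won w
    · obtain ⟨w, hw⟩ := hw
      simp only [G.winReward_of_won hw, G.moveProb_of_won γ hw]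
      cases w <;> cases ℓ <;> simp
    · push Not at hw
      have h0 : ∀ ℓ x, G.winReward ℓ s x = 0 := fun ℓ x => by simp [winReward, hw ℓ]
      rw [h0, h0, add_zero, zero_add, ← sum_moveProb hγ hG hw (fun ℓ => τ ℓ [])]
      exact Finset.sum_le_sum fun b _ => mul_le_of_le_one_right' (ih _ _ )

theorem victoryProb_ne_top (hγ : IsSuccessFunction γ) (hG : G.ProperChances) (ℓ : Player) (s : S)
    (τ : Profile) : G.victoryProb γ ℓ s τ ≠ ⊤ :=
  ((le_self_add.trans (victoryProb_add_le_one hγ hG s τ ℓ)).trans_lt ENNReal.one_lt_top).ne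

/-- The expected payoff as a real number, for strategies of finite expected cost. -/
noncomputable def realPayoff (G : Contest S) (γ : ℝ → ℝ) (v : ℝ) (ℓ : Player) (s : S)
    (τ : Profile) : ℝ :=
  v / 2 * (1 + (G.victoryProb γ ℓ s τ).toReal - (G.victoryProb γ (!ℓ) s τ).toReal) -
    (G.effort γ ℓ s τ).toReal

theorem prizeMoney_eq (hγ : IsSuccessFunction γ) (hG : G.ProperChances) {v : ℝ} (hv : 0 ≤ v)
    (ℓ : Player) (s : S) (τ : Profile) :
    G.prizeMoney γ v ℓ s τ = ENNReal.ofReal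
      (v / 2 * (1 + (G.victoryProb γ ℓ s τ).toReal - (G.victoryProb γ (!ℓ) s τ).toReal)) := by
  have hle := victoryProb_add_le_one hγ hG s τ ℓ
  have h1 := victoryProb_ne_top hγ hG ℓ s τ
  have h2 := victoryProb_ne_top hγ hG (!ℓ) s τ
  have hsum : G.victoryProb γ true s τ + G.victoryProb γ false s τ =
      G.victoryProb γ ℓ s τ + G.victoryProb γ (!ℓ) s τ := by
    cases ℓ <;> simp [add_comm]
  rw [prizeMoney, hsum]
  lift G.victoryProb γ ℓ s τ to ℝ≥0 using h1 with p
  lift G.victoryProb γ (!ℓ) s τ to ℝ≥0 using h2 with p'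
  have hle' : (p : ℝ) + p' ≤ 1 := by exact_mod_cast hle
  simp only [ENNReal.coe_toReal]
  rw [← ENNReal.ofReal_coe_nnreal, ← ENNReal.ofReal_coe_nnreal, ← ENNReal.ofReal_one,
    ← ENNReal.ofReal_add (by positivity) (by positivity),
    ← ENNReal.ofReal_sub _ (by positivity), ← ENNReal.ofReal_mul hv,
    ← ENNReal.ofReal_mul (by positivity), ← ENNReal.ofReal_add (by positivity)]
  · congr 1
    ring
  · exact mul_nonneg (by positivity) (by linarith)

theorem payoff_eq_coe (hγ : IsSuccessFunction γ) (hG : G.ProperChances) {v : ℝ} (hv : 0 ≤ v)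
    {ℓ : Player} {s : S} {τ : Profile} (hτ : G.effort γ ℓ s τ ≠ ⊤) :
    G.payoff γ v ℓ s τ = (G.realPayoff γ v ℓ s τ : EReal) := by
  have hle := victoryProb_add_le_one hγ hG s τ ℓ
  have hle' := ENNReal.toReal_mono ENNReal.one_ne_top hle
  rw [ENNReal.toReal_add (victoryProb_ne_top hγ hG _ _ _) (victoryProb_ne_top hγ hG _ _ _),
    ENNReal.toReal_one] at hle'
  have hp : 0 ≤ (G.victoryProb γ ℓ s τ).toReal := ENNReal.toReal_nonneg
  rw [payoff, prizeMoney_eq hγ hG hv, realPayoff, EReal.coe_sub, EReal.coe_ennreal_ofReal,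
    max_eq_left (mul_nonneg (by positivity) (by linarith)), EReal.coe_ennreal_toReal hτ]

theorem payoff_of_effort_eq_top {v : ℝ} {ℓ : Player} {s : S} {τ : Profile}
    (hτ : G.effort γ ℓ s τ = ⊤) : G.payoff γ v ℓ s τ = ⊥ := by
  rw [payoff, hτ, EReal.coe_ennreal_top, EReal.sub_top]

theorem victoryProb_of_won {s : S} {w : Player} (hs : G.stage s = .won w) (ℓ : Player)
    (τ : Profile) : G.victoryProb γ ℓ s τ = if w = ℓ then 1 else 0 := by
  rw [victoryProb_eq_expReward, G.expReward_of_won γ _ hs, G.winReward_of_won hs]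

theorem effort_of_won {s : S} {w : Player} (hs : G.stage s = .won w) (ℓ : Player)
    (τ : Profile) : G.effort γ ℓ s τ = 0 := by
  rw [effort_eq_expReward, G.expReward_of_won γ _ hs, G.effortReward_of_won hs]

theorem realPayoff_of_won {v : ℝ} {s : S} {w : Player} (hs : G.stage s = .won w) (ℓ : Player)
    (τ : Profile) : G.realPayoff γ v ℓ s τ = if w = ℓ then v else 0 := by
  rw [realPayoff, victoryProb_of_won hs, victoryProb_of_won hs, effort_of_won hs]
  cases w <;> cases ℓ <;> simp <;> ring

theorem victoryProb_step {s : S} (hs : ∀ w, G.stage s ≠ .won w) (ℓ : Player) (τ : Profile) :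
    G.victoryProb γ ℓ s τ =
      ∑ b : Bool, G.moveProb γ s (fun ℓ => τ ℓ []) b *
        G.victoryProb γ ℓ (G.step s b) (τ.tail b) := by
  simp only [victoryProb_eq_expReward]
  rw [expReward_eq]
  simp [winReward, hs ℓ]

theorem toReal_sum_bool {p X : Bool → ℝ≥0∞} (hp : ∀ b, p b ≠ ⊤) (hX : ∀ b, X b ≠ ⊤) :
    (∑ b : Bool, p b * X b).toReal = ∑ b : Bool, (p b).toReal * (X b).toReal := by
  rw [ENNReal.toReal_sum fun b _ => ENNReal.mul_ne_top (hp b) (hX b)]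
  simp

/-- The payoff is the expected payoff after the next move, less the effort at a battle. -/
theorem realPayoff_step (hγ : IsSuccessFunction γ) (hG : G.ProperChances) (v : ℝ) {s : S}
    (hs : ∀ w, G.stage s ≠ .won w) {ℓ : Player} {τ : Profile} {x : ℝ≥0}
    (hx : G.effortReward ℓ s (fun ℓ => τ ℓ []) = x)
    (hτ : ∀ b, G.effort γ ℓ (G.step s b) (τ.tail b) ≠ ⊤) :
    G.effort γ ℓ s τ ≠ ⊤ ∧ G.realPayoff γ v ℓ s τ =
      ∑ b : Bool, (G.moveProb γ s (fun ℓ => τ ℓ []) b).toReal *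
        G.realPayoff γ v ℓ (G.step s b) (τ.tail b) - x := by
  have hp : ∀ b, G.moveProb γ s (fun ℓ => τ ℓ []) b ≠ ⊤ := fun b => moveProb_ne_top s _ b
  have he : G.effort γ ℓ s τ = x + ∑ b : Bool, G.moveProb γ s (fun ℓ => τ ℓ []) b *
      G.effort γ ℓ (G.step s b) (τ.tail b) := by
    simp only [effort_eq_expReward]
    rw [expReward_eq, hx]
  have hfin : ∑ b : Bool, G.moveProb γ s (fun ℓ => τ ℓ []) b *
      G.effort γ ℓ (G.step s b) (τ.tail b) ≠ ⊤ :=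
    ENNReal.sum_ne_top.2 fun b _ => ENNReal.mul_ne_top (hp b) (hτ b)
  refine ⟨by rw [he]; exact ENNReal.add_ne_top.2 ⟨ENNReal.coe_ne_top, hfin⟩, ?_⟩
  have h1 : ∑ b : Bool, (G.moveProb γ s (fun ℓ => τ ℓ []) b).toReal = 1 := by
    rw [← ENNReal.toReal_sum fun b _ => hp b, sum_moveProb hγ hG hs, ENNReal.toReal_one]
  unfold realPayoff
  rw [victoryProb_step hs, victoryProb_step hs, he,
    ENNReal.toReal_add ENNReal.coe_ne_top hfin, toReal_sum_bool hp hτ,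
    toReal_sum_bool hp fun b => victoryProb_ne_top hγ hG _ _ _,
    toReal_sum_bool hp fun b => victoryProb_ne_top hγ hG _ _ _, ENNReal.coe_toReal]
  simp only [Fintype.sum_bool] at h1 ⊢
  linear_combination (-v / 2) * h1

/-! ### Markov perfect equilibria -/

/-- The state `s` can be reached, with whatever probability. -/
def Reachable (G : Contest S) (s : S) : Prop := ∃ h, s = G.run G.init h

theorem Reachable.step {s : S} (hs : G.Reachable s) (b : Bool) : G.Reachable (G.step s b) := by
  obtain ⟨h, rfl⟩ := hs
  exact ⟨h ++ [b], by rw [run_append]; rfl⟩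

theorem reachable_init : G.Reachable G.init := ⟨[], rfl⟩

/-- The continuation value as a real number. -/
noncomputable def realValue (G : Contest S) (γ : ℝ → ℝ) (v : ℝ) (σ : MarkovProfile S)
    (ℓ : Player) (s : S) : ℝ :=
  G.realPayoff γ v ℓ s (G.induced σ s)

theorem realValue_of_won {v : ℝ} {σ : MarkovProfile S} {s : S} {w : Player}
    (hs : G.stage s = .won w) (ℓ : Player) :
    G.realValue γ v σ ℓ s = if w = ℓ then v else 0 :=
  realPayoff_of_won hs ℓ _

/-- A player can secure a nonnegative payoff by idling, so that an equilibrium strategy has a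
finite expected cost. -/
theorem IsMPE.value_nonneg {v : ℝ} {σ : MarkovProfile S} (hσ : G.IsMPE γ v σ) {s : S}
    (hs : G.Reachable s) (ℓ : Player) : 0 ≤ G.value γ v σ ℓ s := by
  obtain ⟨h, rfl⟩ := hs
  refine le_trans ?_ (hσ h ℓ 0)
  have h0 : G.effort γ ℓ (G.run G.init h)
      (Function.update (G.induced σ (G.run G.init h)) ℓ 0) = 0 := by
    simp [effort]
  rw [payoff, h0]
  simpa using EReal.coe_ennreal_nonneg _

theorem IsMPE.effort_ne_top {v : ℝ} {σ : MarkovProfile S} (hσ : G.IsMPE γ v σ) {s : S}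
    (hs : G.Reachable s) (ℓ : Player) : G.effort γ ℓ s (G.induced σ s) ≠ ⊤ := by
  intro hc
  have h := hσ.value_nonneg hs ℓ
  rw [value, payoff_of_effort_eq_top hc] at h
  simp at h

theorem IsMPE.value_eq_coe (hγ : IsSuccessFunction γ) (hG : G.ProperChances) {v : ℝ}
    (hv : 0 ≤ v) {σ : MarkovProfile S} (hσ : G.IsMPE γ v σ) {s : S} (hs : G.Reachable s)
    (ℓ : Player) : G.value γ v σ ℓ s = (G.realValue γ v σ ℓ s : EReal) :=
  payoff_eq_coe hγ hG hv (hσ.effort_ne_top hs ℓ)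

theorem IsMPE.realValue_nonneg (hγ : IsSuccessFunction γ) (hG : G.ProperChances) {v : ℝ}
    (hv : 0 ≤ v) {σ : MarkovProfile S} (hσ : G.IsMPE γ v σ) {s : S} (hs : G.Reachable s)
    (ℓ : Player) : 0 ≤ G.realValue γ v σ ℓ s := by
  have := hσ.value_nonneg hs ℓ
  rw [hσ.value_eq_coe hγ hG hv hs] at this
  exact_mod_cast this

theorem IsMPE.realValue_of_chance (hγ : IsSuccessFunction γ) (hG : G.ProperChances) {v : ℝ}
    {σ : MarkovProfile S} (hσ : G.IsMPE γ v σ) {s : S} (hs : G.Reachable s)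
    {q : ℝ} {next : Bool → S} (hst : G.stage s = .chance q next) (ℓ : Player) :
    G.realValue γ v σ ℓ s =
      q * G.realValue γ v σ ℓ (next true) + (1 - q) * G.realValue γ v σ ℓ (next false) := by
  obtain ⟨h0, h1⟩ := hG s q next hst
  rw [realValue, (realPayoff_step hγ hG v (x := 0) (by simp [hst])
    (by rw [G.effortReward_of_chance hst]; rfl)
    fun b => by rw [induced_tail]; exact hσ.effort_ne_top (hs.step b) ℓ).2]
  simp [G.moveProb_of_chance γ hst, ENNReal.toReal_ofReal h0,
    ENNReal.toReal_ofReal (sub_nonneg.2 h1), induced_tail, G.step_of_chance hst, realValue]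

/-- In an equilibrium no player can gain at a battle by changing the effort of this battle only,
so that the values at the battle are determined by the values after it. -/
theorem IsMPE.battleValues (hγ : IsSuccessFunction γ) (hG : G.ProperChances) {v : ℝ}
    (hv : 0 ≤ v) {σ : MarkovProfile S} (hσ : G.IsMPE γ v σ) {s : S} (hs : G.Reachable s)
    {next : Player → S} (hst : G.stage s = .battle next) :
    BattleValues γ (fun ℓ b => G.realValue γ v σ ℓ (next b)) (fun ℓ => G.realValue γ v σ ℓ s) ∧
      ∀ ℓ, 0 < battleProb γ (σ ℓ s) (σ (!ℓ) s) := by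
  have hw : ∀ w, G.stage s ≠ .won w := by simp [hst]
  have hsum : ∀ (p : Bool → ℝ) (X : Bool → ℝ) (ℓ : Player),
      ∑ b : Bool, p b * X b = p ℓ * X ℓ + p (!ℓ) * X (!ℓ) := by
    rintro p X (_ | _) <;> simp [add_comm]
  refine battleValues_of_optimal hγ (e := fun ℓ => σ ℓ s) (fun ℓ => ?_) fun ℓ x => ?_
  · rw [realValue, (realPayoff_step hγ hG v hw (x := σ ℓ s)
      (by rw [G.effortReward_of_battle hst]; rfl)
      fun b => by rw [induced_tail]; exact hσ.effort_ne_top (hs.step b) ℓ).2, hsum _ _ ℓ]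
    simp only [G.moveProb_of_battle γ hst, ENNReal.toReal_ofReal (battleProb_nonneg hγ _ _),
      induced_tail, G.step_of_battle hst, Bool.not_not, induced_nil]
    rw [← eq_sub_of_add_eq' (battleProb_add hγ (σ ℓ s) (σ (!ℓ) s))]
    rfl
  · -- The deviation to the effort `x` at `s` only.
    set d : List Bool → ℝ≥0 := fun h => if h = [] then x else G.induced σ s ℓ h with hd
    set τ : Profile := Function.update (G.induced σ s) ℓ d with hτ
    have h0 : τ ℓ [] = x := by simp [hτ, hd]
    have h1 : τ (!ℓ) [] = σ (!ℓ) s := by simp [hτ, induced_nil]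
    have htail : ∀ b, τ.tail b = G.induced σ (G.step s b) := by
      intro b
      rw [← induced_tail]
      funext k g
      by_cases hk : k = ℓ
      · subst hk
        simp [Profile.tail, hτ, hd]
      · simp [Profile.tail, hτ, hk]
    have hstep := realPayoff_step hγ hG v hw (ℓ := ℓ) (τ := τ) (x := x)
      (by rw [G.effortReward_of_battle hst, h0])
      fun b => by rw [htail]; exact hσ.effort_ne_top (hs.step b) ℓ
    have hdev : G.payoff γ v ℓ s τ ≤ G.value γ v σ ℓ s := by
      obtain ⟨h, rfl⟩ := hs
      exact hσ h ℓ d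
    rw [hσ.value_eq_coe hγ hG hv hs, payoff_eq_coe hγ hG hv hstep.1, hstep.2,
      EReal.coe_le_coe_iff, hsum _ _ ℓ] at hdev
    simp only [G.moveProb_of_battle γ hst, ENNReal.toReal_ofReal (battleProb_nonneg hγ _ _),
      htail, G.step_of_battle hst, Bool.not_not, h0, h1] at hdev
    rw [eq_sub_of_add_eq' (battleProb_add hγ x (σ (!ℓ) s))] at hdev
    exact hdev

/-- Under a symmetric profile mirror images have the same values, up to the players' names. -/
theorem IsSymmetric.realValue_eq {v : ℝ} {σ : MarkovProfile S} (hσ : G.IsSymmetric σ)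
    {R : S → S → Prop} (hR : G.IsMirror R) {s s' : S} (hss : R s s') (ℓ : Player) :
    G.realValue γ v σ ℓ s = G.realValue γ v σ (!ℓ) s' := by
  have key : ∀ c c' : S → (Player → ℝ≥0) → ℝ≥0∞,
      (∀ s s', R s s' → c s (fun ℓ => σ ℓ s) = c' s' (fun ℓ => σ ℓ s')) →
      G.expReward γ c s (G.induced σ s) = G.expReward γ c' s' (G.induced σ s') := by
    intro c c' hc
    have hn : ∀ (n : ℕ) (s s' : S), R s s' → G.rewardUpTo γ c n s (G.induced σ s) =
        G.rewardUpTo γ c' n s' (G.induced σ s') := by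
      intro n
      induction n with
      | zero => intro s s' _; rfl
      | succ n ih =>
        intro s s' h
        simp only [rewardUpTo, induced_nil, induced_tail]
        rw [hc s s' h]
        congr 1
        have hm := hR s s' h
        have hsym := hσ R hR s s' h
        cases hs : G.stage s with
        | won w =>
          cases hs' : G.stage s' with
          | won w' => simp [G.moveProb_of_won γ hs, G.moveProb_of_won γ hs']
          | battle _ => simp [hs, hs'] at hm
          | chance _ _ => simp [hs, hs'] at hm
        | battle next =>
          cases hs' : G.stage s' with
          | won w' => simp [hs, hs'] at hm
          | battle next' =>
            simp only [hs, hs'] at hm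
            have h1 := hsym ⟨next, hs⟩ true
            have h2 := hsym ⟨next, hs⟩ false
            simp only [Bool.not_true, Bool.not_false] at h1 h2
            have h3 := ih _ _ (hm true)
            have h4 := ih _ _ (hm false)
            simp only [Bool.not_true, Bool.not_false] at h3 h4
            simp only [Fintype.sum_bool, G.moveProb_of_battle γ hs, G.moveProb_of_battle γ hs',
              G.step_of_battle hs, G.step_of_battle hs', h1, h2, h3, h4, Bool.not_true,
              Bool.not_false]
            rw [add_comm]
          | chance _ _ => simp [hs, hs'] at hm
        | chance q next =>
          cases hs' : G.stage s' with
          | won w' => simp [hs, hs'] at hm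
          | battle _ => simp [hs, hs'] at hm
          | chance q' next' =>
            simp only [hs, hs'] at hm
            obtain ⟨rfl, hm⟩ := hm
            refine Finset.sum_congr rfl fun b _ => ?_
            rw [G.moveProb_of_chance γ hs, G.moveProb_of_chance γ hs', G.step_of_chance hs,
              G.step_of_chance hs', ih _ _ (hm b)]
    refine le_antisymm ?_ ?_
    · exact G.expReward_le_of_rewardUpTo_le γ _ fun n => by
        rw [hn n s s' hss]; exact G.rewardUpTo_le γ _ n _ _
    · exact G.expReward_le_of_rewardUpTo_le γ _ fun n => by
        rw [← hn n s s' hss]; exact G.rewardUpTo_le γ _ n _ _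
  have hwin : ∀ ℓ, G.victoryProb γ ℓ s (G.induced σ s) =
      G.victoryProb γ (!ℓ) s' (G.induced σ s') := by
    intro ℓ
    rw [victoryProb_eq_expReward, victoryProb_eq_expReward]
    refine key _ _ fun t t' h => ?_
    have hm := hR t t' h
    cases ht : G.stage t <;> cases ht' : G.stage t' <;> simp only [ht, ht'] at hm
    · rw [G.winReward_of_won ht, G.winReward_of_won ht', hm]
      simp
    · rw [G.winReward_of_battle ht, G.winReward_of_battle ht']
    · rw [G.winReward_of_chance ht, G.winReward_of_chance ht']
  have heff : G.effort γ ℓ s (G.induced σ s) = G.effort γ (!ℓ) s' (G.induced σ s') := by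
    rw [effort_eq_expReward, effort_eq_expReward]
    refine key _ _ fun t t' h => ?_
    have hm := hR t t' h
    have hsym := hσ R hR t t' h
    cases ht : G.stage t <;> cases ht' : G.stage t' <;> simp only [ht, ht'] at hm
    · rw [G.effortReward_of_won ht, G.effortReward_of_won ht']
    · rw [G.effortReward_of_battle ht, G.effortReward_of_battle ht', hsym ⟨_, ht⟩ ℓ]
    · rw [G.effortReward_of_chance ht, G.effortReward_of_chance ht']
  rw [realValue, realValue, realPayoff, realPayoff, hwin ℓ, hwin (!ℓ), heff]

end Contest

/-! ### Values in a single battle -/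

namespace BattleValues

variable {γ : ℝ → ℝ} {a : Player → Player → ℝ} {V : Player → ℝ}

/-- No player gets more than the expected continuation value. -/
theorem exists_le_average (hγ : IsSuccessFunction γ) (h : BattleValues γ a V) :
    ∃ p : ℝ, 0 < p ∧ p < 1 ∧ ∀ ℓ, V ℓ ≤ p * a ℓ true + (1 - p) * a ℓ false := by
  rcases h with h | h
  · refine ⟨1 / 2, by norm_num, by norm_num, fun ℓ => ?_⟩
    rw [(h ℓ).2]
    cases ℓ <;> simp <;> linarith
  · have hT := h true
    have hF := h false
    simp only [Bool.not_true, Bool.not_false] at hT hF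
    have hz : 0 < a true true - a true false := by linarith [hT.1]
    have hz' : 0 < a false false - a false true := by linarith [hF.1]
    have hr := div_pos hz hz'
    refine ⟨γ ((a true true - a true false) / (a false false - a false true)), hγ.pos hr,
      hγ.lt_one hr, ?_⟩
    have hr' := div_pos hz' hz
    have hinv := hγ.add_inv' hr
    rw [inv_div] at hinv
    rintro (_ | _)
    · have := mul_le_mul_of_nonneg_left (hγ.rent_lt hr').le hz'.le
      rw [hF.2]
      rw [← eq_sub_of_add_eq' hinv]
      rw [eq_sub_of_add_eq hinv]
      linarith
    · have := mul_le_mul_of_nonneg_left (hγ.rent_lt hr).le hz.le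
      rw [hT.2]
      linarith

/-- In a contested battle the joint surplus falls short of the joint surplus after a victory of
the player with the larger prize: his bid and his risk of a defeat cost him more than the
opponent gains. -/
theorem surplus_lt_of_favorite (hγ : IsSuccessFunction γ)
    (h : ∀ ℓ, a ℓ (!ℓ) < a ℓ ℓ ∧ V ℓ = a ℓ (!ℓ) +
      (a ℓ ℓ - a ℓ (!ℓ)) * rent γ ((a ℓ ℓ - a ℓ (!ℓ)) / (a (!ℓ) (!ℓ) - a (!ℓ) ℓ)))
    {ℓ : Player} (hℓ : a (!ℓ) (!ℓ) - a (!ℓ) ℓ ≤ a ℓ ℓ - a ℓ (!ℓ)) :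
    V ℓ + V (!ℓ) < a ℓ ℓ + a (!ℓ) ℓ := by
  have h1 := h ℓ
  have h2 := h (!ℓ)
  rw [Bool.not_not] at h2
  set z := a ℓ ℓ - a ℓ (!ℓ) with hz
  set z' := a (!ℓ) (!ℓ) - a (!ℓ) ℓ with hz'
  have hzpos : 0 < z := by linarith [h1.1]
  have hzpos' : 0 < z' := by linarith [h2.1]
  have hr := div_pos hzpos hzpos'
  have h3 := hγ.one_sub_rent hr
  have h4 := hγ.rent_inv hr
  have hm := hγ.bid_pos hr
  rw [inv_div] at h3 h4
  have h5 : 0 ≤ rent γ (z' / z) := hγ.rent_nonneg (div_pos hzpos' hzpos)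
  have h6 : rent γ (z' / z) < 1 - rent γ (z / z') := by linarith
  have h7 : z' * rent γ (z' / z) < z * (1 - rent γ (z / z')) := by
    calc z' * rent γ (z' / z) ≤ z * rent γ (z' / z) := mul_le_mul_of_nonneg_right hℓ h5
      _ < _ := mul_lt_mul_of_pos_left h6 hzpos
  rw [h1.2, h2.2]
  linarith

/-- A contested battle costs the player `ℓ` at least the probability of a defeat: he loses
`γ t` of his prize when the opponent's prize is `t` times his. -/
theorem le_of_contested (hγ : IsSuccessFunction γ)
    (h : ∀ ℓ, a ℓ (!ℓ) < a ℓ ℓ ∧ V ℓ = a ℓ (!ℓ) +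
      (a ℓ ℓ - a ℓ (!ℓ)) * rent γ ((a ℓ ℓ - a ℓ (!ℓ)) / (a (!ℓ) (!ℓ) - a (!ℓ) ℓ)))
    (ℓ : Player) :
    V ℓ ≤ a ℓ ℓ - (a ℓ ℓ - a ℓ (!ℓ)) *
      γ ((a (!ℓ) (!ℓ) - a (!ℓ) ℓ) / (a ℓ ℓ - a ℓ (!ℓ))) := by
  have h1 := h ℓ
  have h2 := h (!ℓ)
  rw [Bool.not_not] at h2
  set z := a ℓ ℓ - a ℓ (!ℓ) with hz
  set z' := a (!ℓ) (!ℓ) - a (!ℓ) ℓ with hz'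
  have hzpos : 0 < z := by linarith [h1.1]
  have hzpos' : 0 < z' := by linarith [h2.1]
  have hr := div_pos hzpos hzpos'
  have h3 := hγ.one_sub_rent hr
  have hm := hγ.bid_pos hr
  rw [inv_div] at h3
  have h4 : z * γ (z' / z) ≤ z * (1 - rent γ (z / z')) :=
    mul_le_mul_of_nonneg_left (by linarith) hzpos.le
  rw [h1.2]
  linarith

end BattleValues

/-! ### Values in a subcontest -/

namespace Subcontest

variable {S : Type*} {M : Subcontest S} {γ : ℝ → ℝ}

theorem stage_of_winner_eq_none {s : S} (hs : M.winner s = none) :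
    M.standalone.stage s = .battle (M.next s) := by
  simp [standalone, hs]

theorem stage_of_winner_eq_some {s : S} {w : Bool} (hs : M.winner s = some w) :
    M.standalone.stage s = .won w := by
  simp [standalone, hs]

theorem reachable_next {s : S} (hr : M.standalone.Reachable s) (hs : M.winner s = none)
    (b : Bool) : M.standalone.Reachable (M.next s b) := by
  have := hr.step b
  rwa [Contest.step_of_battle _ (stage_of_winner_eq_none hs)] at this

theorem properChances_standalone : M.standalone.ProperChances := by
  intro s q next hs
  cases h : M.winner s <;> simp [standalone, h] at hs

/-- If a subcontest can always end, then play cannot be confined to states before its end. -/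
theorem CanAlwaysEnd.not_closed (hM : M.CanAlwaysEnd) {T : Set S}
    (hT : ∀ s ∈ T, M.standalone.Reachable s ∧ M.winner s = none ∧ ∀ b, M.next s b ∈ T) :
    T = ∅ := by
  by_contra hne
  obtain ⟨s, hs⟩ := Set.nonempty_iff_ne_empty.2 hne
  obtain ⟨h, rfl⟩ := (hT s hs).1
  obtain ⟨g, hg⟩ := hM h
  rw [show M.init = M.standalone.init from rfl, Contest.run_append] at hg
  have hrun : ∀ (g : List Bool) (s : S), s ∈ T → M.standalone.run s g ∈ T := by
    intro g
    induction g with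
    | nil => exact fun s hs => hs
    | cons b g ih =>
      intro s hs
      rw [Contest.run_cons, Contest.step_of_battle _ (stage_of_winner_eq_none (hT s hs).2.1)]
      exact ih _ ((hT s hs).2.2 b)
  exact hg (hT _ (hrun g _ hs)).2.1

/-- A function that increases on average, or along some move, at every state of a set of
non-terminal states which is closed under the moves in question forces the set to be empty. -/
theorem CanAlwaysEnd.not_closed_of_increasing [Finite S] (hM : M.CanAlwaysEnd) (f : S → ℝ)
    {T : Set S} (hT : ∀ s ∈ T, M.standalone.Reachable s ∧ M.winner s = none ∧
      (((∀ b, M.next s b ∈ T) ∧ ∃ p : ℝ, 0 < p ∧ p < 1 ∧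
        f s ≤ p * f (M.next s true) + (1 - p) * f (M.next s false)) ∨
      ∃ b, M.next s b ∈ T ∧ f s < f (M.next s b))) :
    T = ∅ := by
  by_contra hne
  obtain ⟨m, hm, hmax⟩ := Set.exists_max_image T f T.toFinite (Set.nonempty_iff_ne_empty.2 hne)
  -- The states where `f` is maximal are closed under all moves.
  have hempty : {s | s ∈ T ∧ f s = f m} = ∅ := by
    refine hM.not_closed fun s hs => ?_
    obtain ⟨hr, hw, h⟩ := hT s hs.1
    refine ⟨hr, hw, ?_⟩
    rcases h with ⟨hb, p, hp0, hp1, hle⟩ | ⟨b, hb, hlt⟩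
    · have h1 := hmax _ (hb true)
      have h2 := hmax _ (hb false)
      rw [hs.2] at hle
      have h3 : f m ≤ f (M.next s true) := by nlinarith
      have h4 : f m ≤ f (M.next s false) := by nlinarith
      rintro (_ | _)
      · exact ⟨hb false, le_antisymm h2 h4⟩
      · exact ⟨hb true, le_antisymm h1 h3⟩
    · have := hmax _ hb
      rw [hs.2] at hlt
      linarith
  exact (hempty ▸ (show m ∈ {s | s ∈ T ∧ f s = f m} from ⟨hm, rfl⟩) : m ∈ (∅ : Set S))

/-- Maximum principle: a function that increases on average is bounded by its terminal values. -/
theorem CanAlwaysEnd.le_of_terminal_le [Finite S] (hM : M.CanAlwaysEnd) {f : S → ℝ} {B : ℝ}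
    (hf : ∀ s, M.standalone.Reachable s → M.winner s = none → ∃ p : ℝ, 0 < p ∧ p < 1 ∧
      f s ≤ p * f (M.next s true) + (1 - p) * f (M.next s false))
    (hB : ∀ s w, M.standalone.Reachable s → M.winner s = some w → f s ≤ B)
    {s : S} (hs : M.standalone.Reachable s) : f s ≤ B := by
  obtain ⟨m, hm, hmax⟩ := Set.exists_max_image {s | M.standalone.Reachable s} f (Set.toFinite _)
    ⟨s, hs⟩
  by_contra! hlt
  have hBm : B < f m := hlt.trans_le (hmax s hs)
  have hempty : {t | M.standalone.Reachable t ∧ f t = f m} = ∅ := by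
    refine hM.not_closed fun t ht => ?_
    have hw : M.winner t = none := by
      cases hw : M.winner t with
      | none => rfl
      | some w =>
        have := hB t w ht.1 hw
        rw [ht.2] at this
        linarith
    refine ⟨ht.1, hw, ?_⟩
    obtain ⟨p, hp0, hp1, hle⟩ := hf t ht.1 hw
    have hb := fun b => reachable_next ht.1 hw b
    have h1 := hmax _ (hb true)
    have h2 := hmax _ (hb false)
    rw [ht.2] at hle
    have h3 : f m ≤ f (M.next t true) := by nlinarith
    have h4 : f m ≤ f (M.next t false) := by nlinarith
    rintro (_ | _)
    · exact ⟨hb false, le_antisymm h2 h4⟩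
    · exact ⟨hb true, le_antisymm h1 h3⟩
  exact (hempty ▸ (show m ∈ {t | M.standalone.Reachable t ∧ f t = f m} from ⟨hm, rfl⟩) :
    m ∈ (∅ : Set S))

/-- The properties of the equilibrium values of a subcontest with prize `1` on which the estimates
rest: `V ℓ s` is the value of role `ℓ` at state `s`. -/
structure IsValueSystem (M : Subcontest S) (γ : ℝ → ℝ) (V : Player → S → ℝ) : Prop where
  nonneg : ∀ s, M.standalone.Reachable s → ∀ ℓ, 0 ≤ V ℓ s
  terminal : ∀ s w, M.standalone.Reachable s → M.winner s = some w →
    ∀ ℓ, V ℓ s = if w = ℓ then 1 else 0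
  battle : ∀ s, M.standalone.Reachable s → M.winner s = none →
    BattleValues γ (fun ℓ b => V ℓ (M.next s b)) (fun ℓ => V ℓ s)

theorem isValueSystem_of_isMPE (hγ : IsSuccessFunction γ) {σ : MarkovProfile S}
    (hσ : M.standalone.IsMPE γ 1 σ) :
    M.IsValueSystem γ (fun ℓ s => M.standalone.realValue γ 1 σ ℓ s) where
  nonneg _ hs ℓ := hσ.realValue_nonneg hγ properChances_standalone zero_le_one hs ℓ
  terminal _ _ _ hw ℓ := Contest.realValue_of_won (stage_of_winner_eq_some hw) ℓ
  battle _ hs hw := (hσ.battleValues hγ properChances_standalone zero_le_one hs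
    (stage_of_winner_eq_none hw)).1

namespace IsValueSystem

variable {V : Player → S → ℝ}

theorem le_one [Finite S] (hγ : IsSuccessFunction γ) (hM : M.CanAlwaysEnd)
    (hV : M.IsValueSystem γ V) {s : S} (hs : M.standalone.Reachable s) (ℓ : Player) :
    V ℓ s ≤ 1 := by
  refine hM.le_of_terminal_le (f := V ℓ) (fun t ht hw => ?_) (fun t w ht hw => ?_) hs
  · obtain ⟨p, hp0, hp1, h⟩ := (hV.battle t ht hw).exists_le_average hγ
    exact ⟨p, hp0, hp1, h ℓ⟩
  · rw [hV.terminal t w ht hw]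
    split_ifs <;> norm_num

theorem add_le_one [Finite S] (hγ : IsSuccessFunction γ) (hM : M.CanAlwaysEnd)
    (hV : M.IsValueSystem γ V) {s : S} (hs : M.standalone.Reachable s) :
    V true s + V false s ≤ 1 := by
  refine hM.le_of_terminal_le (f := fun s => V true s + V false s) (fun t ht hw => ?_)
    (fun t w ht hw => ?_) hs
  · obtain ⟨p, hp0, hp1, h⟩ := (hV.battle t ht hw).exists_le_average hγ
    exact ⟨p, hp0, hp1, by linarith [h true, h false]⟩
  · simp only [hV.terminal t w ht hw]
    cases w <;> norm_num

/-- If the challenger has a positive value then he wins along some history. -/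
theorem exists_run_of_pos [Finite S] (hγ : IsSuccessFunction γ) (hM : M.CanAlwaysEnd)
    (hV : M.IsValueSystem γ V) (hpos : 0 < V false M.init) :
    ∃ h, M.winner (M.standalone.run M.init h) = some false := by
  by_contra! hne
  refine hpos.not_ge (hM.le_of_terminal_le (f := V false) (fun t ht hw => ?_)
    (fun t w ht hw => ?_) (Contest.reachable_init (G := M.standalone)))
  · obtain ⟨p, hp0, hp1, h⟩ := (hV.battle t ht hw).exists_le_average hγ
    exact ⟨p, hp0, hp1, h false⟩
  · obtain ⟨h, rfl⟩ := ht
    cases w with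
    | false => exact absurd hw (hne h)
    | true => simp [hV.terminal _ _ ⟨h, rfl⟩ hw]

end IsValueSystem

/-- If rents are always positive, then the value of the challenger at a state from which he can
win is bounded away from `0`, by a bound that depends only on the way to his victory. -/
theorem exists_le_value_challenger [Finite S] (hγ : IsSuccessFunction γ) (hM : M.CanAlwaysEnd)
    (hrent : ∀ t, 0 < t → 0 < rent γ t) (h : List Bool) :
    ∃ c : ℝ, 0 < c ∧ c ≤ 1 ∧ ∀ V, M.IsValueSystem γ V → ∀ s, M.standalone.Reachable s →
      M.winner (M.standalone.run s h) = some false → c ≤ V false s := by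
  induction h with
  | nil =>
    refine ⟨1, one_pos, le_rfl, fun V hV s hs hw => ?_⟩
    rw [Contest.run_nil] at hw
    simp [hV.terminal s false hs hw]
  | cons b h ih =>
    obtain ⟨c, hc0, hc1, hc⟩ := ih
    have hc2 : 0 < c / 2 := by linarith
    refine ⟨min (c / 2) (c / 2 * rent γ (c / 2)), lt_min hc2 (mul_pos hc2 (hrent _ hc2)),
      (min_le_left _ _).trans (by linarith), fun V hV s hs hw => ?_⟩
    cases hst : M.winner s with
    | some w =>
      rw [Contest.run_cons, Contest.step_of_won _ (stage_of_winner_eq_some hst)] at hw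
      exact (min_le_left _ _).trans ((by linarith : c / 2 ≤ c).trans (hc V hV s hs hw))
    | none =>
      rw [Contest.run_cons, Contest.step_of_battle _ (stage_of_winner_eq_none hst)] at hw
      have hr := fun b => reachable_next hs hst b
      have hb : c ≤ V false (M.next s b) := hc V hV _ (hr b) hw
      have hnn := fun b => hV.nonneg _ (hr b)
      rcases hV.battle s hs hst with hZ | hI
      · refine (min_le_left _ _).trans ?_
        have hZF := (hZ false).2
        simp only [Bool.not_false] at hZF
        rw [hZF]
        have h1 := hnn true false
        have h2 := hnn false false
        cases b <;> linarith
      · have hT := hI true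
        have hF := hI false
        simp only [Bool.not_true, Bool.not_false] at hT hF
        have hz : 0 < V true (M.next s true) - V true (M.next s false) := by linarith [hT.1]
        have hz1 : V true (M.next s true) - V true (M.next s false) ≤ 1 := by
          linarith [hV.le_one hγ hM (hr true) true, hnn false true]
        have hz' : 0 < V false (M.next s false) - V false (M.next s true) := by
          linarith [hF.1]
        rw [hF.2]
        by_cases hcase : c / 2 ≤ V false (M.next s true)
        · have h1 := mul_nonneg hz'.le (hγ.rent_nonneg (div_pos hz' hz))
          exact (min_le_left _ _).trans (by linarith)
        · have hbF : b = false := by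
            cases b with
            | false => rfl
            | true => exact absurd (by linarith) hcase
          subst hbF
          have hge : c / 2 ≤ V false (M.next s false) - V false (M.next s true) := by linarith
          have hge' : c / 2 ≤ (V false (M.next s false) - V false (M.next s true)) /
              (V true (M.next s true) - V true (M.next s false)) := by
            rw [le_div_iff₀ hz]
            nlinarith
          refine (min_le_right _ _).trans ?_
          have h1 := hγ.rent_mono hc2 hge'
          have h2 := mul_le_mul hge h1 (hrent _ hc2).le hz'.le
          linarith [hnn true false]

/-- If rents vanish for `t ≤ t₀`, a small loss of the incumbent leaves the challenger without any
value. The states where the loss of the incumbent is small, on a suitable scale, contain with each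
state both of its successors, except where the challenger is so weak that he gets no rent, and then
they contain the successor after a victory of the incumbent. The states among these where the value
of the challenger is maximal would trap the players. -/
theorem value_challenger_le_zero [Finite S] (hγ : IsSuccessFunction γ) (hM : M.CanAlwaysEnd)
    {t₀ : ℝ} (ht0 : 0 < t₀) (ht1 : t₀ ≤ 1) (hrent : rent γ t₀ = 0) {V : Player → S → ℝ}
    (hV : M.IsValueSystem γ V)
    (hloss : 1 - V true M.init ≤ 1 / (2 * (2 + 1 / γ t₀) ^ (Nat.card S + 1))) :
    V false M.init ≤ 0 := by
  set C : ℝ := 2 + 1 / γ t₀ with hC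
  have hγ0 : 0 < γ t₀ := hγ.pos ht0
  have hC2 : 2 < C := by
    have : 0 < 1 / γ t₀ := by positivity
    linarith
  have hC0 : 0 < C := by linarith
  set n := Nat.card S with hn
  set η : ℕ → ℝ := fun j => C ^ j * (1 / (2 * C ^ (n + 1))) with hη
  have hηpos : ∀ j, 0 < η j := fun j => by positivity
  have hηsucc : ∀ j, η (j + 1) = C * η j := fun j => by simp only [hη]; ring
  set A : ℕ → Set S := fun j => {s | M.standalone.Reachable s ∧ 1 - V true s ≤ η j} with hA
  have hmono : ∀ j, A j ⊆ A (j + 1) := by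
    intro j s hs
    refine ⟨hs.1, hs.2.trans ?_⟩
    rw [hηsucc]
    nlinarith [hηpos j]
  have hηle : ∀ j, j ≤ n → η j < 1 := by
    intro j hj
    have h1 : C ^ j ≤ C ^ (n + 1) := pow_le_pow_right₀ (by linarith) (by omega)
    have h2 : 0 < C ^ (n + 1) := by positivity
    simp only [hη, mul_one_div]
    rw [div_lt_one (by positivity)]
    linarith
  -- An increasing chain of sets of states becomes stationary.
  obtain ⟨j, hjn, hj⟩ : ∃ j ≤ n, A (j + 1) ⊆ A j := by
    by_contra! hcon
    have hcard : ∀ j ≤ n + 1, j ≤ (A j).ncard := by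
      intro j
      induction j with
      | zero => exact fun _ => Nat.zero_le _
      | succ j ih =>
        intro hj
        have h1 := Set.ncard_lt_ncard
          ((hmono j).ssubset_of_not_subset (hcon j (by omega))) (Set.toFinite _)
        have h2 := ih (by omega)
        omega
    have h1 := hcard (n + 1) le_rfl
    have h2 := Set.ncard_le_card (A (n + 1))
    omega
  have hstep : ∀ s, M.standalone.Reachable s → 1 - V true s ≤ C * η j → s ∈ A j := by
    intro s hs h
    exact hj ⟨hs, by rwa [hηsucc]⟩
  have hinit : M.init ∈ A j := by
    have hsub : A 0 ⊆ A j := monotone_nat_of_le_succ hmono (Nat.zero_le j)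
    refine hsub ⟨Contest.reachable_init (G := M.standalone), ?_⟩
    simpa [hη] using hloss
  by_contra! hpos
  obtain ⟨m, hm, hmax⟩ := Set.exists_max_image (A j) (V false) (Set.toFinite _) ⟨_, hinit⟩
  have hmpos : 0 < V false m := hpos.trans_le (hmax _ hinit)
  have hempty : {s | s ∈ A j ∧ V false s = V false m} = ∅ := by
    refine hM.not_closed_of_increasing (fun s => V true s + V false s) fun s hs => ?_
    obtain ⟨⟨hr, hsη⟩, hsm⟩ := hs
    have hηj := hηle j hjn
    have hηj0 := hηpos j
    have hw : M.winner s = none := by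
      cases hw : M.winner s with
      | none => rfl
      | some w =>
        have h1 := hV.terminal s w hr hw true
        have h2 := hV.terminal s w hr hw false
        cases w
        · simp at h1
          linarith
        · simp at h2
          linarith
    refine ⟨hr, hw, ?_⟩
    have hrn := fun b => reachable_next hr hw b
    have hle := fun b => hV.le_one hγ hM (hrn b) true
    have hB := hV.battle s hr hw
    have havg := hB.exists_le_average hγ
    rcases hB with hZ | hI
    · have hZT := hZ true
      have hZF := hZ false
      simp only [Bool.not_true, Bool.not_false] at hZT hZF
      have hmem : ∀ b, M.next s b ∈ A j := by
        intro b
        refine hstep _ (hrn b) ?_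
        have h1 := hle true
        have h2 := hle false
        cases b <;> nlinarith
      have h1 := hmax _ (hmem true)
      have h2 := hmax _ (hmem false)
      left
      refine ⟨?_, 1 / 2, by norm_num, by norm_num, by linarith⟩
      rintro (_ | _)
      · exact ⟨hmem false, by linarith⟩
      · exact ⟨hmem true, by linarith⟩
    · have hloss := BattleValues.le_of_contested (a := fun ℓ b => V ℓ (M.next s b))
        (V := fun ℓ => V ℓ s) hγ hI true
      have hfav := BattleValues.surplus_lt_of_favorite (a := fun ℓ b => V ℓ (M.next s b))
        (V := fun ℓ => V ℓ s) hγ hI (ℓ := true)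
      have hT := hI true
      have hF := hI false
      simp only [Bool.not_true, Bool.not_false] at hT hF hloss hfav
      set z := V true (M.next s true) - V true (M.next s false) with hz
      set z' := V false (M.next s false) - V false (M.next s true) with hz'
      have hzpos : 0 < z := by linarith [hT.1]
      have hzpos' : 0 < z' := by linarith [hF.1]
      have hγt : 0 < γ (z' / z) := hγ.pos (div_pos hzpos' hzpos)
      have hmemT : M.next s true ∈ A j := by
        refine hstep _ (hrn true) ?_
        nlinarith [mul_pos hzpos hγt]
      rcases le_or_gt (z' / z) t₀ with hcase | hcase
      · -- The challenger gets no rent, and follows the incumbent's way to victory.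
        have h0 : rent γ (z' / z) = 0 :=
          le_antisymm (hrent ▸ hγ.rent_mono (div_pos hzpos' hzpos) hcase)
            (hγ.rent_nonneg (div_pos hzpos' hzpos))
        right
        refine ⟨true, ⟨hmemT, ?_⟩, ?_⟩
        · rw [← hsm, hF.2, h0]
          ring
        · refine hfav ?_
          have := (div_le_iff₀ hzpos).1 (hcase.trans ht1)
          linarith
      · -- The prize of the incumbent is small, and so is his loss after a defeat.
        have h1 : γ t₀ ≤ γ (z' / z) :=
          (hγ.strictMonoOn (Set.mem_Ici.2 ht0.le)
            (Set.mem_Ici.2 (div_pos hzpos' hzpos).le) hcase).le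
        have h2 : z * γ t₀ ≤ η j := by
          have := mul_le_mul_of_nonneg_left h1 hzpos.le
          linarith [hle true]
        have h3 : z ≤ 1 / γ t₀ * η j := by
          rw [one_div_mul_eq_div, le_div_iff₀ hγ0]
          exact h2
        have hmemF : M.next s false ∈ A j := by
          refine hstep _ (hrn false) ?_
          have h4 := mul_pos hzpos hγt
          rw [hC]
          linarith
        obtain ⟨p, hp0, hp1, havg⟩ := havg
        have hlt : ∀ b, M.next s b ∈ {s | s ∈ A j ∧ V false s = V false m} := by
          have h4 := hmax _ hmemT
          have h5 := hmax _ hmemF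
          have h6 := havg false
          rw [hsm] at h6
          rintro (_ | _)
          · exact ⟨hmemF, le_antisymm h5 (by nlinarith)⟩
          · exact ⟨hmemT, le_antisymm h4 (by nlinarith)⟩
        left
        exact ⟨hlt, p, hp0, hp1, by linarith [havg true, havg false]⟩
  exact (hempty ▸ (show m ∈ {s | s ∈ A j ∧ V false s = V false m} from ⟨hm, rfl⟩) :
    m ∈ (∅ : Set S))

/-- The loss of the incumbent is bounded away from `0`, uniformly over all equilibria that leave
the challenger a positive value. -/
theorem exists_loss_bound [Finite S] (hγ : IsSuccessFunction γ) (hM : M.CanAlwaysEnd) :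
    ∃ c : ℝ, 0 < c ∧ c ≤ 1 ∧ ∀ V, M.IsValueSystem γ V → 0 < V false M.init →
      c ≤ 1 - V true M.init := by
  by_cases hrent : ∀ t, 0 < t → 0 < rent γ t
  · by_cases hex : ∃ h, M.winner (M.standalone.run M.init h) = some false
    · obtain ⟨h, hh⟩ := hex
      obtain ⟨c, hc0, hc1, hc⟩ := exists_le_value_challenger hγ hM hrent h
      refine ⟨c, hc0, hc1, fun V hV _ => ?_⟩
      have h1 := hc V hV _ (Contest.reachable_init (G := M.standalone)) hh
      have h2 := hV.add_le_one hγ hM (Contest.reachable_init (G := M.standalone))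
      exact h1.trans (le_sub_iff_add_le'.2 h2)
    · exact ⟨1, one_pos, le_rfl, fun V hV hpos =>
        absurd (hV.exists_run_of_pos hγ hM hpos) hex⟩
  · push Not at hrent
    obtain ⟨t, ht, hrt⟩ := hrent
    have ht' : 0 < min t 1 := lt_min ht one_pos
    have h0 : rent γ (min t 1) = 0 :=
      le_antisymm ((hγ.rent_mono ht' (min_le_left _ _)).trans hrt) (hγ.rent_nonneg ht')
    have hγ0 : 0 < γ (min t 1) := hγ.pos ht'
    have hC : 1 ≤ (2 + 1 / γ (min t 1)) ^ (Nat.card S + 1) := by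
      refine one_le_pow₀ ?_
      have : 0 < 1 / γ (min t 1) := by positivity
      linarith
    refine ⟨1 / (2 * (2 + 1 / γ (min t 1)) ^ (Nat.card S + 1)), by positivity, ?_,
      fun V hV hpos => ?_⟩
    · rw [div_le_one (by positivity)]
      linarith
    · by_contra! hlt
      exact hpos.not_ge
        (value_challenger_le_zero hγ hM ht' (min_le_right _ _) h0 hV hlt.le)

end Subcontest

/-! ### Sufficiently biased subcontests -/

/-- If the prize of a player is `r ≥ 1` times the opponent's then his loss exceeds the opponent's
rent, relative to the prizes, by a factor that is bounded away from `1` for bounded `r`. -/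
theorem IsSuccessFunction.mul_rent_inv_le {γ : ℝ → ℝ} (hγ : IsSuccessFunction γ) {r R : ℝ}
    (hr : 1 ≤ r) (hrR : r ≤ R) : (1 + deriv γ R) * rent γ r⁻¹ ≤ 1 - rent γ r := by
  have hr0 : 0 < r := by linarith
  have hR0 : 0 < R := by linarith
  have h1 := hγ.antitoneOn_deriv hr0 hR0 hrR
  have h2 := hγ.deriv_pos R hR0
  have h3 := hγ.rent_lt_one (inv_pos.2 hr0)
  have h4 := hγ.one_sub_rent hr0
  have h5 := hγ.rent_inv hr0
  have h6 : deriv γ R ≤ r * deriv γ r := by nlinarith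
  nlinarith

theorem IsSuccessFunction.rent_inv_le {γ : ℝ → ℝ} (hγ : IsSuccessFunction γ) {r : ℝ}
    (hr : 0 < r) : rent γ r⁻¹ ≤ 1 - rent γ r := by
  have h4 := hγ.one_sub_rent hr
  have h5 := hγ.rent_inv hr
  have h6 := hγ.bid_pos hr
  linarith

/-- Ratios of prizes that evolve as in a sequence of battles between a favorite and an underdog,
where the underdog always has a positive rent, become large. The rent of the underdog at the end
is positive too: if it vanished for large ratios, then it would have vanished before. -/
theorem IsSuccessFunction.exists_ratio_bound {γ : ℝ → ℝ} (hγ : IsSuccessFunction γ) (ε : ℝ) :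
    ∃ K₀ : ℕ, ∀ K, K₀ ≤ K → ∀ r : ℕ → ℝ, 1 ≤ r 0 →
      (∀ j < K, 0 < rent γ (r j)⁻¹ ∧
        r j * (1 - rent γ (r j)) ≤ r (j + 1) * rent γ (r j)⁻¹) →
      1 / ε < r K ∧ 0 < rent γ (r K)⁻¹ := by
  obtain ⟨R, hR1, hRε, hR⟩ : ∃ R : ℝ, 1 ≤ R ∧ 1 / ε ≤ R ∧
      ((∀ t, 0 < t → 0 < rent γ t) ∨ ∀ r, R < r → rent γ r⁻¹ = 0) := by
    by_cases hrent : ∀ t, 0 < t → 0 < rent γ t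
    · exact ⟨max 1 (1 / ε), le_max_left _ _, le_max_right _ _, Or.inl hrent⟩
    · push Not at hrent
      obtain ⟨t, ht, hrt⟩ := hrent
      refine ⟨max (max 1 (1 / ε)) t⁻¹, (le_max_left _ _).trans (le_max_left _ _),
        (le_max_right _ _).trans (le_max_left _ _), Or.inr fun r hr => ?_⟩
      have h1 : t⁻¹ < r := (le_max_right _ _).trans_lt hr
      have h2 : 0 < r := (inv_pos.2 ht).trans h1
      have h3 : r⁻¹ ≤ t := (inv_lt_of_inv_lt₀ ht h1).le
      exact le_antisymm ((hγ.rent_mono (inv_pos.2 h2) h3).trans hrt)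
        (hγ.rent_nonneg (inv_pos.2 h2))
  have hκ : 0 < deriv γ R := hγ.deriv_pos R (by linarith)
  obtain ⟨n, hn⟩ := pow_unbounded_of_one_lt R (by linarith : 1 < 1 + deriv γ R)
  refine ⟨n + 1, fun K hK r h0 hr => ?_⟩
  have hgrow : ∀ j ≤ K, 1 ≤ r j ∧ (R < r j ∨ (1 + deriv γ R) ^ j ≤ r j) := by
    intro j
    induction j with
    | zero => exact fun _ => ⟨h0, Or.inr (by simpa using h0)⟩
    | succ j ih =>
      intro hj
      obtain ⟨h1, h2⟩ := ih (by omega)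
      obtain ⟨h3, h4⟩ := hr j (by omega)
      have h5 := hγ.rent_inv_le (by linarith : 0 < r j)
      have h6 : r j ≤ r (j + 1) := by
        refine le_of_mul_le_mul_right ?_ h3
        nlinarith
      refine ⟨h1.trans h6, ?_⟩
      rcases lt_or_ge R (r j) with h7 | h7
      · exact Or.inl (h7.trans_le h6)
      · right
        have h8 : (1 + deriv γ R) ^ j ≤ r j := h2.resolve_left h7.not_gt
        have h9 := hγ.mul_rent_inv_le h1 h7
        have h10 : r j * (1 + deriv γ R) ≤ r (j + 1) := by
          refine le_of_mul_le_mul_right ?_ h3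
          nlinarith
        rw [pow_succ]
        nlinarith
  have hlarge : ∀ j ≤ K, n ≤ j → R < r j := by
    intro j hj hnj
    rcases (hgrow j hj).2 with h | h
    · exact h
    · exact (hn.trans_le (pow_le_pow_right₀ (by linarith) hnj)).trans_le h
  have hK1 := hlarge K le_rfl (by omega)
  refine ⟨hRε.trans_lt hK1, ?_⟩
  rcases hR with hR | hR
  · exact hR _ (inv_pos.2 (by linarith))
  · have h1 := (hr (K - 1) (by omega)).1
    rw [hR _ (hlarge (K - 1) (by omega) (by omega))] at h1
    exact absurd h1 (lt_irrefl 0)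

/-! ### The race -/

section Race

variable {γ : ℝ → ℝ}

/-- The state of the race at which the challenger still needs `j ≤ K` victories. -/
def raceState (K j : ℕ) : Option (Fin (K + 1)) := some ⟨min j K, by omega⟩

theorem raceState_self (K : ℕ) : raceState K K = (oneWinRace K).init := by
  simp [raceState, oneWinRace, Fin.last]

theorem oneWinRace_canAlwaysEnd (K : ℕ) : (oneWinRace K).CanAlwaysEnd := by
  intro h
  refine ⟨[true], ?_⟩
  rw [Contest.run_append]
  set s := (oneWinRace K).standalone.run (oneWinRace K).init h
  rw [Contest.run_cons, Contest.run_nil]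
  cases hs : (oneWinRace K).winner s with
  | some w =>
    rw [Contest.step_of_won _ (Subcontest.stage_of_winner_eq_some hs), hs]
    simp
  | none =>
    rw [Contest.step_of_battle _ (Subcontest.stage_of_winner_eq_none hs)]
    cases s <;> simp [oneWinRace]

theorem oneWinRace_sufficientlyBiased (hγ : IsSuccessFunction γ) (ε : ℝ) :
    ∃ K₀ : ℕ, ∀ K, K₀ ≤ K → (oneWinRace K).SufficientlyBiased γ ε := by
  obtain ⟨K₀, hK₀⟩ := hγ.exists_ratio_bound ε
  refine ⟨K₀ + 1, fun K hK σ hσ => ?_⟩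
  have hV := Subcontest.isValueSystem_of_isMPE hγ hσ.1
  have hinit : (oneWinRace K).standalone.Reachable (oneWinRace K).init :=
    Contest.reachable_init (G := (oneWinRace K).standalone)
  rw [hσ.1.value_eq_coe hγ Subcontest.properChances_standalone zero_le_one hinit,
    hσ.1.value_eq_coe hγ Subcontest.properChances_standalone zero_le_one hinit,
    EReal.toReal_coe, EReal.toReal_coe]
  set V : Player → Option (Fin (K + 1)) → ℝ :=
    fun ℓ s => (oneWinRace K).standalone.realValue γ 1 σ ℓ s with hVdef
  have hwin : ∀ j, 0 < j → j ≤ K → (oneWinRace K).winner (raceState K j) = none := by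
    intro j h0 hj
    simp [oneWinRace, raceState]
    omega
  have hnextF : ∀ j, j + 1 ≤ K →
      (oneWinRace K).next (raceState K (j + 1)) false = raceState K j := by
    intro j hj
    simp [oneWinRace, raceState]
    omega
  have hnextT : ∀ j, (oneWinRace K).next (raceState K j) true = none := by
    intro j
    simp [oneWinRace, raceState]
  have hreach : ∀ i ≤ K, (oneWinRace K).standalone.Reachable (raceState K (K - i)) := by
    intro i
    induction i with
    | zero => exact fun _ => by rw [Nat.sub_zero, raceState_self]; exact hinit
    | succ i ih =>
      intro hi
      have h1 := Subcontest.reachable_next (ih (by omega)) (hwin _ (by omega) (by omega)) false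
      rwa [show K - i = K - (i + 1) + 1 by omega, hnextF _ (by omega)] at h1
  have hreach' : ∀ j ≤ K, (oneWinRace K).standalone.Reachable (raceState K j) := by
    intro j hj
    have := hreach (K - j) (by omega)
    rwa [show K - (K - j) = j by omega] at this
  have hreachN : (oneWinRace K).standalone.Reachable none := by
    have := Subcontest.reachable_next (hreach' K le_rfl) (hwin K (by omega) le_rfl) true
    rwa [hnextT] at this
  have hNone : ∀ ℓ, V ℓ none = if true = ℓ then 1 else 0 :=
    hV.terminal none true hreachN (by simp [oneWinRace])
  have hZero : ∀ ℓ, V ℓ (raceState K 0) = if false = ℓ then 1 else 0 :=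
    hV.terminal _ false (hreach' 0 (Nat.zero_le K)) (by simp [oneWinRace, raceState])
  -- The loss of the incumbent and the value of the challenger.
  set a : ℕ → ℝ := fun j => 1 - V true (raceState K j) with ha
  set b : ℕ → ℝ := fun j => V false (raceState K j) with hb
  have ha0 : a 0 = 1 := by simp [ha, hZero]
  have hb0 : b 0 = 1 := by simp [hb, hZero]
  have hbattle : ∀ j < K, (a j ≤ 0 ∧ b j ≤ 0) ∨ (0 < a j ∧ 0 < b j ∧
      a (j + 1) = a j * (1 - rent γ (a j / b j)) ∧ b (j + 1) = b j * rent γ (a j / b j)⁻¹) := by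
    intro j hj
    have hB := hV.battle _ (hreach' (j + 1) hj) (hwin (j + 1) (by omega) hj)
    have hT : V true none = 1 := by simp [hNone]
    have hF : V false none = 0 := by simp [hNone]
    rcases hB with h | h
    · left
      have h1 := (h true).1
      have h2 := (h false).1
      simp only [Bool.not_true, Bool.not_false, hnextT, hnextF j hj] at h1 h2
      change V true none ≤ V true (raceState K j) at h1
      change V false (raceState K j) ≤ V false none at h2
      exact ⟨by simp only [ha]; linarith, by simp only [hb]; linarith⟩
    · right
      have h1 := h true
      have h2 := h false
      simp only [Bool.not_true, Bool.not_false, hnextT, hnextF j hj] at h1 h2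
      change V true (raceState K j) < V true none ∧ V true (raceState K (j + 1)) =
        V true (raceState K j) + (V true none - V true (raceState K j)) *
          rent γ ((V true none - V true (raceState K j)) /
            (V false (raceState K j) - V false none)) at h1
      change V false none < V false (raceState K j) ∧ V false (raceState K (j + 1)) =
        V false none + (V false (raceState K j) - V false none) *
          rent γ ((V false (raceState K j) - V false none) /
            (V true none - V true (raceState K j))) at h2
      rw [hT, hF, sub_zero] at h1 h2
      rw [inv_div]
      refine ⟨by simp only [ha]; linarith [h1.1], h2.1, ?_, by simpa using h2.2⟩
      simp only [ha, hb]
      rw [h1.2]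
      ring
  have hI : ∀ j, j < K → 0 < a j ∧ 0 < b j := by
    have hapos : ∀ j ≤ K, 0 < a j := by
      intro j
      induction j with
      | zero => exact fun _ => by rw [ha0]; exact one_pos
      | succ j ih =>
        intro hj
        rcases hbattle j (by omega) with h | ⟨h1, h2, h3, -⟩
        · exact absurd (ih (by omega)) h.1.not_gt
        · rw [h3]
          exact mul_pos h1 (sub_pos.2 (hγ.rent_lt_one (div_pos h1 h2)))
    intro j hj
    rcases hbattle j hj with h | ⟨h1, h2, -, -⟩
    · exact absurd (hapos j hj.le) h.1.not_gt
    · exact ⟨h1, h2⟩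
  have hrec : ∀ j < K, a (j + 1) = a j * (1 - rent γ (a j / b j)) ∧
      b (j + 1) = b j * rent γ (a j / b j)⁻¹ := by
    intro j hj
    rcases hbattle j hj with h | ⟨-, -, h⟩
    · exact absurd (hI j hj).1 h.1.not_gt
    · exact h
  obtain ⟨h1, h2⟩ := hK₀ (K - 1) (by omega) (fun j => a j / b j) (by simp [ha0, hb0]) (by
    intro j hj
    obtain ⟨h1, h2⟩ := hrec j (by omega)
    have h3 := (hI j (by omega)).2
    have h4 := (hI (j + 1) (by omega)).2
    have h5 : 0 < rent γ (a j / b j)⁻¹ := by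
      rw [h2] at h4
      exact pos_of_mul_pos_right h4 h3.le
    refine ⟨h5, le_of_eq ?_⟩
    rw [h1, h2]
    have h6 := h5.ne'
    generalize rent γ (a j / b j)⁻¹ = ρ at h6 ⊢
    field_simp)
  obtain ⟨h3, h4⟩ := hrec (K - 1) (by omega)
  obtain ⟨h5, h6⟩ := hI (K - 1) (by omega)
  have h7 := hγ.rent_inv_le (div_pos h5 h6)
  rw [show K - 1 + 1 = K by omega] at h3 h4
  rw [← raceState_self]
  change a K / b K > 1 / ε
  refine lt_of_lt_of_le h1 ?_
  rw [h3, h4, mul_div_mul_comm]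
  refine le_mul_of_one_le_right (div_pos h5 h6).le ?_
  rwa [one_le_div h2]

end Race

/-! ### The tug-of-war with a head start -/

section TugOfWar

variable {γ : ℝ → ℝ}

/-- In a tug-of-war with `n + 1` positions, where `u k` is the value of a player at position `k`
and `u (n - k)` the value of the opponent, every battle is contested: an idle battle would make
the values decrease from one end to the other. -/
theorem tugOfWar_contested (hγ : IsSuccessFunction γ) {n : ℕ} (hn : 2 ≤ n) {u : ℕ → ℝ}
    (h0 : u 0 = 0) (h1 : u n = 1)
    (hu : ∀ k, 1 ≤ k → k < n →
      (u (k + 1) ≤ u (k - 1) ∧ u (n - k + 1) ≤ u (n - k - 1) ∧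
        u k = (u (k + 1) + u (k - 1)) / 2) ∨
      (u (k - 1) < u (k + 1) ∧ u (n - k - 1) < u (n - k + 1) ∧
        u k = u (k - 1) + (u (k + 1) - u (k - 1)) *
          rent γ ((u (k + 1) - u (k - 1)) / (u (n - k + 1) - u (n - k - 1))))) :
    ∀ k, 1 ≤ k → k < n → u (k - 1) < u (k + 1) ∧ u (n - k - 1) < u (n - k + 1) ∧
        u k = u (k - 1) + (u (k + 1) - u (k - 1)) *
          rent γ ((u (k + 1) - u (k - 1)) / (u (n - k + 1) - u (n - k - 1))) := by
  have hidle : ∀ k, 1 ≤ k → k < n → u (k + 1) ≤ u (k - 1) → u k ≤ u (k - 1) := by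
    intro k hk hkn h
    rcases hu k hk hkn with h' | h'
    · linarith [h'.2.2]
    · linarith [h'.1]
  have hdown : ∀ k, 1 ≤ k → k + 1 < n → u (k + 2) ≤ u k → u (k + 1) ≤ u (k - 1) := by
    intro k hk hkn h
    by_contra! hlt
    rcases hu k hk (by omega) with h' | ⟨h2, h3, h4⟩
    · linarith [h'.1]
    · have h5 := hidle (k + 1) (by omega) hkn h
      have h6 := hγ.rent_lt_one (div_pos (sub_pos.2 h2) (sub_pos.2 h3))
      have h7 := mul_lt_mul_of_pos_left h6 (sub_pos.2 h2)
      simp only [Nat.add_sub_cancel] at h5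
      linarith
  have hall : ∀ k, 1 ≤ k → k < n → u (k + 1) ≤ u (k - 1) →
      ∀ i, 1 ≤ i → i ≤ k → u (i + 1) ≤ u (i - 1) := by
    intro k
    induction k with
    | zero => omega
    | succ k ih =>
      intro hk hkn h i hi hik
      rcases Nat.lt_or_ge k i with hlt | hge
      · obtain rfl : i = k + 1 := by omega
        exact h
      · exact ih (by omega) (by omega) (hdown k (by omega) hkn h) i hi hge
  intro k hk hkn
  rcases hu k hk hkn with h | h
  · exfalso
    have h2 := hall k hk hkn h.1 1 le_rfl hk
    -- By symmetry, an idle battle at one end entails an idle battle at the other end.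
    have h3 : u (n - 1 + 1) ≤ u (n - 1 - 1) := by
      rcases hu 1 le_rfl (by omega) with h' | h'
      · exact h'.2.1
      · exact absurd h'.1 h2.not_gt
    have h4 := hall (n - 1) (by omega) (by omega) h3
    have h5 : ∀ j, j < n → u j ≤ 0 := by
      intro j
      induction j with
      | zero => exact fun _ => h0.le
      | succ j ih =>
        intro hj
        have h6 := hidle (j + 1) (by omega) hj (h4 (j + 1) (by omega) (by omega))
        rw [Nat.add_sub_cancel] at h6
        exact h6.trans (ih (by omega))
    rw [show n - 1 + 1 = n by omega, h1] at h3
    linarith [h5 (n - 1 - 1) (by omega)]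
  · exact h

/-- The position `k` of the tug-of-war with margin `K + 1`. -/
def tugState (K k : ℕ) : Fin (2 * K + 3) := ⟨min k (2 * K + 2), by omega⟩

theorem tugState_init (K : ℕ) : tugState K (2 * K + 1) = (headStartTugOfWar K).init := by
  simp [tugState, headStartTugOfWar]

theorem tug_winner_eq_none {K k : ℕ} (h0 : 0 < k) (hk : k < 2 * K + 2) :
    (headStartTugOfWar K).winner (tugState K k) = none := by
  simp only [headStartTugOfWar, tugState]
  rw [if_neg (by omega), if_neg (by omega)]

theorem tug_next_true (K k : ℕ) :
    (headStartTugOfWar K).next (tugState K k) true = tugState K (k + 1) := by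
  simp [headStartTugOfWar, tugState]

theorem tug_next_false {K k : ℕ} (hk : k < 2 * K + 2) :
    (headStartTugOfWar K).next (tugState K k) false = tugState K (k - 1) := by
  simp [headStartTugOfWar, tugState]
  omega

theorem headStartTugOfWar_canAlwaysEnd (K : ℕ) : (headStartTugOfWar K).CanAlwaysEnd := by
  intro h
  rw [show (∃ g, (headStartTugOfWar K).winner ((headStartTugOfWar K).standalone.run
    (headStartTugOfWar K).init (h ++ g)) ≠ none) ↔ ∃ g, (headStartTugOfWar K).winner
    ((headStartTugOfWar K).standalone.run ((headStartTugOfWar K).standalone.run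
    (headStartTugOfWar K).init h) g) ≠ none by simp only [Contest.run_append]]
  generalize (headStartTugOfWar K).standalone.run (headStartTugOfWar K).init h = s
  -- The leader wins after sufficiently many victories in a row.
  have key : ∀ (d : ℕ) (s : Fin (2 * K + 3)), 2 * K + 2 - s.val ≤ d →
      ∃ g, (headStartTugOfWar K).winner ((headStartTugOfWar K).standalone.run s g) ≠ none := by
    intro d
    induction d with
    | zero =>
      intro s hs
      refine ⟨[], ?_⟩
      have : s.val = 2 * K + 2 := by omega
      simp [Contest.run_nil, headStartTugOfWar, this]
    | succ d ih =>
      intro s hs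
      cases hw : (headStartTugOfWar K).winner s with
      | some w => exact ⟨[], by simp [Contest.run_nil, hw]⟩
      | none =>
        obtain ⟨g, hg⟩ := ih ((headStartTugOfWar K).next s true) (by
          simp [headStartTugOfWar]
          omega)
        refine ⟨true :: g, ?_⟩
        rwa [Contest.run_cons, Contest.step_of_battle _ (Subcontest.stage_of_winner_eq_none hw)]
  exact key _ s le_rfl

theorem tug_isMirror (K : ℕ) : (headStartTugOfWar K).standalone.IsMirror
    (fun s s' => s.val + s'.val = 2 * K + 2) := by
  intro s s' h
  by_cases h1 : s.val = 2 * K + 2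
  · have h2 : s' = 0 := Fin.ext (by simp only [Fin.val_zero]; omega)
    simp [Subcontest.standalone, headStartTugOfWar, h1, h2]
  · by_cases h2 : s.val = 0
    · have h3 : s'.val = 2 * K + 2 := by omega
      have h4 : s = 0 := Fin.ext h2
      simp [Subcontest.standalone, headStartTugOfWar, h4, h3]
    · have h3 : s'.val ≠ 2 * K + 2 := by omega
      have h4 : s'.val ≠ 0 := by omega
      simp only [Subcontest.standalone, headStartTugOfWar, h1, h2, h3, h4, if_false]
      rintro (_ | _) <;> simp <;> omega

theorem headStartTugOfWar_sufficientlyBiased (hγ : IsSuccessFunction γ) (ε : ℝ) :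
    ∃ K₀ : ℕ, ∀ K, K₀ ≤ K → (headStartTugOfWar K).SufficientlyBiased γ ε := by
  obtain ⟨K₀, hK₀⟩ := hγ.exists_ratio_bound ε
  refine ⟨K₀, fun K hK σ hσ => ?_⟩
  have hV := Subcontest.isValueSystem_of_isMPE hγ hσ.1
  have hinit : (headStartTugOfWar K).standalone.Reachable (headStartTugOfWar K).init :=
    Contest.reachable_init (G := (headStartTugOfWar K).standalone)
  rw [hσ.1.value_eq_coe hγ Subcontest.properChances_standalone zero_le_one hinit,
    hσ.1.value_eq_coe hγ Subcontest.properChances_standalone zero_le_one hinit,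
    EReal.toReal_coe, EReal.toReal_coe]
  have hmirror : ∀ k ≤ 2 * K + 2,
      (headStartTugOfWar K).standalone.realValue γ 1 σ false (tugState K k) =
        (headStartTugOfWar K).standalone.realValue γ 1 σ true (tugState K (2 * K + 2 - k)) := by
    intro k hk
    refine hσ.2.realValue_eq (tug_isMirror K) ?_ false
    simp [tugState]
    omega
  have hreach : ∀ i ≤ 2 * K + 1,
      (headStartTugOfWar K).standalone.Reachable (tugState K (2 * K + 1 - i)) := by
    intro i
    induction i with
    | zero => exact fun _ => by rw [Nat.sub_zero, tugState_init]; exact hinit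
    | succ i ih =>
      intro hi
      have h1 := Subcontest.reachable_next (ih (by omega))
        (tug_winner_eq_none (by omega) (by omega)) false
      rwa [tug_next_false (by omega), show 2 * K + 1 - i - 1 = 2 * K + 1 - (i + 1) by omega]
        at h1
  have hreach' : ∀ k ≤ 2 * K + 1, (headStartTugOfWar K).standalone.Reachable (tugState K k) := by
    intro k hk
    have := hreach (2 * K + 1 - k) (by omega)
    rwa [show 2 * K + 1 - (2 * K + 1 - k) = k by omega] at this
  have hreachN : (headStartTugOfWar K).standalone.Reachable (tugState K (2 * K + 2)) := by
    have := Subcontest.reachable_next (hreach' (2 * K + 1) le_rfl)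
      (tug_winner_eq_none (by omega) (by omega)) true
    rwa [tug_next_true] at this
  obtain ⟨u, hu⟩ : ∃ u : ℕ → ℝ, ∀ k, u k =
    (headStartTugOfWar K).standalone.realValue γ 1 σ true (tugState K k) := ⟨_, fun _ => rfl⟩
  have hu0 : u 0 = 0 := by
    rw [hu, hV.terminal _ false (hreach' 0 (by omega)) (by simp [headStartTugOfWar, tugState])]
    simp
  have hun : u (2 * K + 2) = 1 := by
    rw [hu, hV.terminal _ true hreachN (by simp [headStartTugOfWar, tugState])]
    simp
  have hI := tugOfWar_contested hγ (n := 2 * K + 2) (by omega) hu0 hun (by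
    intro k hk hkn
    have hB := hV.battle _ (hreach' k (by omega)) (tug_winner_eq_none hk hkn)
    rcases hB with h | h
    · left
      have h1 := h true
      have h2 := h false
      simp only [Bool.not_true, Bool.not_false, tug_next_true, tug_next_false hkn] at h1 h2
      rw [hmirror (k - 1) (by omega), hmirror (k + 1) (by omega)] at h2
      simp only [← hu] at h1 h2
      rw [show 2 * K + 2 - (k - 1) = 2 * K + 2 - k + 1 by omega,
        show 2 * K + 2 - (k + 1) = 2 * K + 2 - k - 1 by omega] at h2
      exact ⟨h1.1, h2.1, h1.2⟩
    · right
      have h1 := h true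
      have h2 := (h false).1
      simp only [Bool.not_true, Bool.not_false, tug_next_true, tug_next_false hkn] at h1 h2
      rw [hmirror (k - 1) (by omega), hmirror (k + 1) (by omega)] at h1 h2
      simp only [← hu] at h1 h2
      rw [show 2 * K + 2 - (k - 1) = 2 * K + 2 - k + 1 by omega,
        show 2 * K + 2 - (k + 1) = 2 * K + 2 - k - 1 by omega] at h1 h2
      exact ⟨h1.1, h2, h1.2⟩)
  -- `z k` is the prize in the battle at `k`, and `r j` is the ratio of the prizes in the battle
  -- in which the lead is `j`.
  obtain ⟨z, hz⟩ : ∃ z : ℕ → ℝ, ∀ k, z k = u (k + 1) - u (k - 1) := ⟨_, fun _ => rfl⟩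
  obtain ⟨r, hr⟩ : ∃ r : ℕ → ℝ, ∀ j, r j = z (K + 1 + j) / z (K + 1 - j) := ⟨_, fun _ => rfl⟩
  have hzpos : ∀ k, 1 ≤ k → k < 2 * K + 2 → 0 < z k := by
    intro k hk hkn
    rw [hz]
    exact sub_pos.2 (hI k hk hkn).1
  have hrent : ∀ k, 1 ≤ k → k < 2 * K + 2 →
      u k - u (k - 1) = z k * rent γ (z k / z (2 * K + 2 - k)) := by
    intro k hk hkn
    have := (hI k hk hkn).2.2
    rw [hz, hz]
    linarith
  have hrpos : ∀ j ≤ K, 0 < r j := by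
    intro j hj
    rw [hr]
    exact div_pos (hzpos _ (by omega) (by omega)) (hzpos _ (by omega) (by omega))
  -- The increments of `u` on both sides of the two positions with lead `j`.
  have hup : ∀ j ≤ K, u (K + 1 + j) - u (K + j) = z (K + 1 + j) * rent γ (r j) := by
    intro j hj
    have := hrent (K + 1 + j) (by omega) (by omega)
    rwa [show K + 1 + j - 1 = K + j by omega,
      show 2 * K + 2 - (K + 1 + j) = K + 1 - j by omega, ← hr] at this
  have hlow : ∀ j ≤ K, u (K + 1 - j) - u (K - j) = z (K + 1 - j) * rent γ (r j)⁻¹ := by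
    intro j hj
    have := hrent (K + 1 - j) (by omega) (by omega)
    rwa [show K + 1 - j - 1 = K - j by omega,
      show 2 * K + 2 - (K + 1 - j) = K + 1 + j by omega, ← inv_div, ← hr] at this
  have hup' : ∀ j ≤ K,
      u (K + 2 + j) - u (K + 1 + j) = z (K + 1 + j) * (1 - rent γ (r j)) := by
    intro j hj
    have h1 := hup j hj
    have h2 := hz (K + 1 + j)
    rw [show K + 1 + j + 1 = K + 2 + j by omega, show K + 1 + j - 1 = K + j by omega] at h2
    linarith
  have hlow' : ∀ j ≤ K,
      u (K + 2 - j) - u (K + 1 - j) = z (K + 1 - j) * (1 - rent γ (r j)⁻¹) := by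
    intro j hj
    have h1 := hlow j hj
    have h2 := hz (K + 1 - j)
    rw [show K + 1 - j + 1 = K + 2 - j by omega, show K + 1 - j - 1 = K - j by omega] at h2
    linarith
  obtain ⟨h1, h2⟩ := hK₀ K hK r (by
      rw [hr, Nat.add_zero, Nat.sub_zero, div_self (hzpos _ (by omega) (by omega)).ne']) (by
    intro j hj
    have hzj := hzpos (K + 1 + j) (by omega) (by omega)
    have hzj' := hzpos (K + 1 - j) (by omega) (by omega)
    have hw := hzpos (K + 1 + (j + 1)) (by omega) (by omega)
    have hw' := hzpos (K + 1 - (j + 1)) (by omega) (by omega)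
    have e1 := hup' j hj.le
    have e2 := hup (j + 1) hj
    have e3 := hlow j hj.le
    have e4 := hlow' (j + 1) hj
    rw [show K + 1 + (j + 1) = K + 2 + j by omega] at e2 hw
    rw [show K + (j + 1) = K + 1 + j by omega] at e2
    rw [show K + 2 - (j + 1) = K + 1 - j by omega, show K + 1 - (j + 1) = K - j by omega] at e4
    rw [show K + 1 - (j + 1) = K - j by omega] at hw'
    have hrj := hrpos j hj.le
    have hrj' := hrpos (j + 1) hj
    have hrj1 : r j * z (K + 1 - j) = z (K + 1 + j) := by
      rw [hr, div_mul_cancel₀ _ hzj'.ne']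
    have hrj2 : r (j + 1) * z (K - j) = z (K + 2 + j) := by
      rw [hr, show K + 1 + (j + 1) = K + 2 + j by omega,
        show K + 1 - (j + 1) = K - j by omega, div_mul_cancel₀ _ hw'.ne']
    have hpos : 0 < rent γ (r j)⁻¹ := by
      have h3 : 0 < z (K + 1 - j) * rent γ (r j)⁻¹ := by
        rw [← e3, e4]
        exact mul_pos hw' (sub_pos.2 (hγ.rent_lt_one (inv_pos.2 hrj')))
      exact pos_of_mul_pos_right h3 hzj'.le
    refine ⟨hpos, ?_⟩
    have h3 : rent γ (r (j + 1)) ≤ 1 - rent γ (r (j + 1))⁻¹ := by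
      have h4 := hγ.rent_inv_le hrj'
      linarith
    refine le_of_mul_le_mul_left ?_ hzj'
    calc z (K + 1 - j) * (r j * (1 - rent γ (r j)))
        = z (K + 1 + j) * (1 - rent γ (r j)) := by rw [← hrj1]; ring
      _ = r (j + 1) * (z (K - j) * rent γ (r (j + 1))) := by
          rw [← e1, e2, ← hrj2]; ring
      _ ≤ r (j + 1) * (z (K - j) * (1 - rent γ (r (j + 1))⁻¹)) := by
          gcongr
      _ = z (K + 1 - j) * (r (j + 1) * rent γ (r j)⁻¹) := by
          rw [← e4, e3]; ring)
  rw [← tugState_init, hmirror _ (by omega), ← hu, ← hu]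
  have e1 := hup' K le_rfl
  have e2 := hlow K le_rfl
  rw [show K + 2 + K = 2 * K + 2 by omega, show K + 1 + K = 2 * K + 1 by omega, hun] at e1
  rw [show K + 1 - K = 1 by omega, Nat.sub_self, hu0, sub_zero] at e2
  have hrK := hr K
  rw [show K + 1 + K = 2 * K + 1 by omega, show K + 1 - K = 1 by omega] at hrK
  have hz1 := hzpos 1 le_rfl (by omega)
  have hzn := hzpos (2 * K + 1) (by omega) (by omega)
  rw [show 2 * K + 2 - (2 * K + 1) = 1 by omega, e1, e2, mul_div_mul_comm, ← hrK]
  refine lt_of_lt_of_le h1 (le_mul_of_one_le_right (hrpos K le_rfl).le ?_)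
  rw [one_le_div h2]
  exact hγ.rent_inv_le (hrpos K le_rfl)

end TugOfWar

/-! ### The iterated incumbency contest -/

namespace Subcontest

variable {S : Type*} {M : Subcontest S} {γ : ℝ → ℝ} {q v : ℝ} {N n : ℕ}

theorem properChances_iterated (hq0 : 0 ≤ q) (hq1 : q ≤ 1) :
    (M.iterated q N).ProperChances := by
  intro s p next hs
  rcases s with _ | ⟨m, i⟩ | ⟨m, i, s⟩
  · simp only [iterated, Stage.chance.injEq] at hs
    rw [← hs.1]
    norm_num
  · by_cases h : m ≤ N
    · simp only [iterated, h, if_true, Stage.chance.injEq] at hs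
      rw [← hs.1]
      exact ⟨hq0, hq1⟩
    · simp [iterated, h] at hs
  · simp [iterated] at hs

theorem stage_toss : (M.iterated q N).stage .toss = .chance (1 / 2) (fun i => .round 1 i) := rfl

theorem stage_round {m : ℕ} (hm : m ≤ N) (i : Player) : (M.iterated q N).stage (.round m i) =
    .chance q (fun b => if b then M.arrive m i M.init else .round (m + 1) i) := by
  simp [iterated, hm]

theorem stage_round_of_lt {m : ℕ} (hm : N < m) (i : Player) :
    (M.iterated q N).stage (.round m i) = .won i := by
  simp [iterated, hm.not_ge]

theorem stage_fight (m : ℕ) (s : S) : (M.iterated q N).stage (.fight m true s) =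
    .battle (fun ℓ => M.arrive m true (M.next s ℓ)) := by
  simp [iterated]

theorem arrive_of_none {s : S} (hs : M.winner s = none) (m : ℕ) (i : Player) :
    M.arrive m i s = .fight m i s := by
  simp [arrive, hs]

theorem arrive_of_some {s : S} {w : Bool} (hs : M.winner s = some w) (m : ℕ) (i : Player) :
    M.arrive m i s = .round (m + 1) (w == i) := by
  simp [arrive, hs]

theorem arrive_true_of_some {s : S} {w : Bool} (hs : M.winner s = some w) (m : ℕ) :
    M.arrive m true s = .round (m + 1) w := by
  simp [arrive, hs]

theorem reachable_round (i : Player) {m : ℕ} (hm : m ≤ N) :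
    (M.iterated q N).Reachable (.round (m + 1) i) := by
  induction m with
  | zero =>
    have := (Contest.reachable_init (G := M.iterated q N)).step i
    rwa [show (M.iterated q N).init = .toss from rfl, Contest.step_of_chance _ stage_toss] at this
  | succ m ih =>
    have := (ih (by omega)).step false
    rwa [Contest.step_of_chance _ (stage_round hm i)] at this

theorem reachable_arrive {m : ℕ} (hm : m < N) {s : S} (hs : M.standalone.Reachable s) :
    (M.iterated q N).Reachable (M.arrive (m + 1) true s) := by
  obtain ⟨h, rfl⟩ := hs
  have key : ∀ (h : List Bool) (s : S), (M.iterated q N).Reachable (M.arrive (m + 1) true s) →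
      (M.iterated q N).Reachable (M.arrive (m + 1) true (M.standalone.run s h)) := by
    intro h
    induction h with
    | nil => exact fun _ hs => hs
    | cons b h ih =>
      intro s hs
      rw [Contest.run_cons]
      refine ih _ ?_
      cases hw : M.winner s with
      | some w => rwa [Contest.step_of_won _ (stage_of_winner_eq_some hw)]
      | none =>
        rw [arrive_of_none hw] at hs
        rw [Contest.step_of_battle _ (stage_of_winner_eq_none hw)]
        have := hs.step b
        rwa [Contest.step_of_battle _ (stage_fight _ s)] at this
  refine key h _ ?_
  have := (reachable_round true hm.le : (M.iterated q N).Reachable _).step true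
  rwa [Contest.step_of_chance _ (stage_round hm true)] at this

/-- Mirror images in the iterated contest: the incumbent is the other player; or, in the same round
with the same incumbent, the states of the subcontest are mirror images according to `R`. -/
inductive IterMirror (M : Subcontest S) (R : S → S → Prop) : IterState S → IterState S → Prop where
  | round (m : ℕ) (i : Player) : IterMirror M R (.round m i) (.round m !i)
  | swap (m : ℕ) (i : Player) (s : S) : IterMirror M R (.fight m i s) (.fight m (!i) s)
  | within (m : ℕ) (i : Player) (s s' : S) (h : R s s') (hs : M.winner s = none) :
      IterMirror M R (.fight m i s) (.fight m i s')

theorem iterMirror_arrive_swap (R : S → S → Prop) (m : ℕ) (i : Player) (s : S) :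
    M.IterMirror R (M.arrive m i s) (M.arrive m (!i) s) := by
  cases hw : M.winner s with
  | none =>
    rw [arrive_of_none hw, arrive_of_none hw]
    exact .swap m i s
  | some w =>
    rw [arrive_of_some hw, arrive_of_some hw, show (w == !i) = !(w == i) by
      cases w <;> cases i <;> rfl]
    exact .round (m + 1) _

theorem iterMirror_arrive_within {R : S → S → Prop} (hR : M.standalone.IsMirror R) (m : ℕ)
    (i : Player) {s s' : S} (h : R s s') :
    M.IterMirror R (M.arrive m i s) (M.arrive m i s') := by
  have hm := hR s s' h
  cases hw : M.winner s with
  | none =>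
    cases hw' : M.winner s' with
    | none =>
      rw [arrive_of_none hw, arrive_of_none hw']
      exact .within m i s s' h hw
    | some w' =>
      simp only [stage_of_winner_eq_none hw, stage_of_winner_eq_some hw'] at hm
  | some w =>
    cases hw' : M.winner s' with
    | none => simp only [stage_of_winner_eq_some hw, stage_of_winner_eq_none hw'] at hm
    | some w' =>
      simp only [stage_of_winner_eq_some hw, stage_of_winner_eq_some hw'] at hm
      rw [arrive_of_some hw, arrive_of_some hw', hm,
        show ((!w) == i) = !(w == i) by cases w <;> cases i <;> rfl]
      exact .round (m + 1) _

theorem isMirror_iterMirror {R : S → S → Prop} (hR : M.standalone.IsMirror R) :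
    (M.iterated q N).IsMirror (M.IterMirror R) := by
  intro s s' h
  cases h with
  | round m i =>
    by_cases hm : m ≤ N
    · rw [stage_round hm, stage_round hm]
      refine ⟨rfl, ?_⟩
      rintro (_ | _)
      · exact .round (m + 1) i
      · exact iterMirror_arrive_swap R m i M.init
    · rw [stage_round_of_lt (not_le.1 hm), stage_round_of_lt (not_le.1 hm)]
  | swap m i s =>
    simp only [iterated]
    intro b
    rw [show ((!b) == !i) = (b == i) by cases b <;> cases i <;> rfl]
    exact iterMirror_arrive_swap R m i _
  | within m i s s' h hs =>
    simp only [iterated]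
    intro b
    have hm := hR s s' h
    rw [show ((!b) == i) = !(b == i) by cases b <;> cases i <;> rfl]
    cases hw' : M.winner s' with
    | some w' => simp only [stage_of_winner_eq_none hs, stage_of_winner_eq_some hw'] at hm
    | none =>
      simp only [stage_of_winner_eq_none hs, stage_of_winner_eq_none hw'] at hm
      exact iterMirror_arrive_within hR m i (hm (b == i))

/-- The values at the beginning of a round depend only on who is the incumbent. -/
theorem realValue_round {σ : MarkovProfile (IterState S)} (hσ : (M.iterated q N).IsSymmetric σ)
    (m : ℕ) (w ℓ : Player) : (M.iterated q N).realValue γ v σ ℓ (.round m w) =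
      if w = ℓ then (M.iterated q N).realValue γ v σ true (.round m true)
      else (M.iterated q N).realValue γ v σ false (.round m true) := by
  have h : ∀ ℓ, (M.iterated q N).realValue γ v σ ℓ (.round m true) =
      (M.iterated q N).realValue γ v σ (!ℓ) (.round m false) := fun ℓ =>
    hσ.realValue_eq (isMirror_iterMirror (R := fun _ _ => False) fun _ _ h => h.elim)
      (.round m true) ℓ
  have h1 := h true
  have h2 := h false
  cases w <;> cases ℓ <;> simp_all

/-! ### Strategies of the subcontest within the iterated contest -/

/-- The strategy of `ℓ` in round `n` of the iterated contest, with `A` as the incumbent, that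
plays the subcontest from `s` by the strategy `τ`, with efforts scaled by `k`, and returns to the
Markov profile `σ` when the subcontest is over. -/
noncomputable def liftStrategy (M : Subcontest S) (q : ℝ) (N n : ℕ) (σ : MarkovProfile (IterState S)) (k : ℝ≥0)
    (ℓ : Player) : S → (List Bool → ℝ≥0) → List Bool → ℝ≥0
  | s, τ, [] => match M.winner s with
    | some w => σ ℓ (.round (n + 1) w)
    | none => k * τ []
  | s, τ, b :: h => match M.winner s with
    | some w => σ ℓ ((M.iterated q N).run (.round (n + 1) w) (b :: h))
    | none => liftStrategy M q N n σ k ℓ (M.next s b) (fun g => τ (b :: g)) h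

/-- The profile of the iterated contest in which both players use lifted strategies. -/
noncomputable def liftProfile (M : Subcontest S) (q : ℝ) (N n : ℕ) (σ : MarkovProfile (IterState S)) (k : ℝ≥0)
    (s : S) (τ : Profile) : Profile :=
  fun ℓ => M.liftStrategy q N n σ k ℓ s (τ ℓ)

variable {σ : MarkovProfile (IterState S)} {k : ℝ≥0}

theorem liftProfile_of_some {s : S} {w : Bool} (hs : M.winner s = some w) (τ : Profile) :
    M.liftProfile q N n σ k s τ = (M.iterated q N).induced σ (.round (n + 1) w) := by
  funext ℓ h
  cases h <;> simp [liftProfile, liftStrategy, hs, Contest.induced, Contest.run_nil]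

theorem liftProfile_nil {s : S} (hs : M.winner s = none) (τ : Profile) :
    (fun ℓ => M.liftProfile q N n σ k s τ ℓ []) = fun ℓ => k * τ ℓ [] := by
  funext ℓ
  simp [liftProfile, liftStrategy, hs]

theorem liftProfile_tail {s : S} (hs : M.winner s = none) (τ : Profile) (b : Bool) :
    (M.liftProfile q N n σ k s τ).tail b = M.liftProfile q N n σ k (M.next s b) (τ.tail b) := by
  funext ℓ h
  simp only [liftProfile, Profile.tail, liftStrategy, hs]
  rfl

/-- The equilibrium strategy is the lift of its restriction to the subcontest. -/
theorem liftStrategy_induced (hk : k ≠ 0) (ℓ : Player) (s : S) :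
    M.liftStrategy q N n σ k ℓ s
      (M.standalone.induced (fun ℓ s => σ ℓ (.fight n true s) / k) s ℓ) =
      (M.iterated q N).induced σ (M.arrive n true s) ℓ := by
  funext h
  induction h generalizing s with
  | nil =>
    cases hw : M.winner s with
    | some w => simp [liftStrategy, hw, arrive_true_of_some hw, Contest.induced, Contest.run_nil]
    | none =>
      simp [liftStrategy, hw, arrive_of_none hw, Contest.induced, Contest.run_nil,
        mul_div_cancel₀ _ hk]
  | cons b h ih =>
    cases hw : M.winner s with
    | some w => simp [liftStrategy, hw, arrive_true_of_some hw, Contest.induced]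
    | none =>
      have h1 := ih (M.next s b)
      simp only [liftStrategy, hw, arrive_of_none hw, Contest.induced, Contest.run_cons,
        Contest.step_of_battle _ (stage_fight n s),
        Contest.step_of_battle _ (stage_of_winner_eq_none hw)] at h1 ⊢
      exact h1

theorem moveProb_fight (hk : k ≠ 0) {s : S} (hs : M.winner s = none) (x : Player → ℝ≥0)
    (b : Bool) : (M.iterated q N).moveProb γ (.fight n true s) (fun ℓ => k * x ℓ) b =
      M.standalone.moveProb γ s x b := by
  rw [Contest.moveProb_of_battle _ γ (stage_fight n s),
    Contest.moveProb_of_battle _ γ (stage_of_winner_eq_none hs), battleProb_mul_mul γ hk]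

/-- A reward of the iterated contest under lifted strategies: it is collected in the subcontest, or
after the subcontest, which is won by either player with the probabilities of the standalone
contest. -/
theorem expReward_lift (hk : k ≠ 0) {c : IterState S → (Player → ℝ≥0) → ℝ≥0∞}
    {c' : S → (Player → ℝ≥0) → ℝ≥0∞}
    (hc : ∀ s, M.winner s = none → ∀ x, c (.fight n true s) (fun ℓ => k * x ℓ) = c' s x)
    (hc' : ∀ s w, M.winner s = some w → ∀ x, c' s x = 0) (s : S) (τ : Profile) :
    (M.iterated q N).expReward γ c (M.arrive n true s) (M.liftProfile q N n σ k s τ) =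
      M.standalone.expReward γ c' s τ + ∑ w : Bool, M.standalone.victoryProb γ w s τ *
        (M.iterated q N).expReward γ c (.round (n + 1) w)
          ((M.iterated q N).induced σ (.round (n + 1) w)) := by
  set Y : Bool → ℝ≥0∞ := fun w => (M.iterated q N).expReward γ c (.round (n + 1) w)
    ((M.iterated q N).induced σ (.round (n + 1) w)) with hY
  set d : S → (Player → ℝ≥0) → ℝ≥0∞ :=
    fun s x => c' s x + ∑ w : Bool, M.standalone.winReward w s x * Y w with hd
  have hlin : M.standalone.expReward γ c' s τ + ∑ w : Bool,
      M.standalone.victoryProb γ w s τ * Y w = M.standalone.expReward γ d s τ := by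
    simp only [Contest.victoryProb_eq_expReward, Contest.expReward, hd, Fintype.sum_bool,
      mul_add, ← mul_assoc, ENNReal.tsum_add, ENNReal.tsum_mul_right]
  rw [hlin]
  have hdsome : ∀ s w, M.winner s = some w → ∀ x, d s x = Y w := by
    intro s w hw x
    simp only [hd, hc' s w hw, Contest.winReward_of_won _ (stage_of_winner_eq_some hw),
      Fintype.sum_bool]
    cases w <;> simp
  have hdnone : ∀ s, M.winner s = none → ∀ x, d s x = c' s x := by
    intro s hw x
    simp [hd, Contest.winReward_of_battle _ (stage_of_winner_eq_none hw)]
  have hEsome : ∀ s w, M.winner s = some w → ∀ τ, M.standalone.expReward γ d s τ = Y w := by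
    intro s w hw τ
    rw [Contest.expReward_of_won _ γ _ (stage_of_winner_eq_some hw), hdsome s w hw]
  have hGsome : ∀ s w, M.winner s = some w → ∀ τ, (M.iterated q N).expReward γ c
      (M.arrive n true s) (M.liftProfile q N n σ k s τ) = Y w := by
    intro s w hw τ
    rw [liftProfile_of_some hw, arrive_true_of_some hw]
  refine le_antisymm ?_ ?_
  · refine Contest.expReward_le_of_rewardUpTo_le _ γ _ fun j => ?_
    clear hlin
    induction j generalizing s τ with
    | zero => simp [Contest.rewardUpTo]
    | succ j ih =>
      cases hw : M.winner s with
      | some w =>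
        rw [hEsome s w hw, ← hGsome s w hw τ]
        exact Contest.rewardUpTo_le _ γ _ _ _ _
      | none =>
        rw [Contest.expReward_eq, Contest.rewardUpTo, arrive_of_none hw, liftProfile_nil hw,
          hc s hw, hdnone s hw]
        refine add_le_add le_rfl (Finset.sum_le_sum fun b _ => ?_)
        rw [moveProb_fight hk hw, liftProfile_tail hw,
          Contest.step_of_battle _ (stage_fight n s),
          Contest.step_of_battle _ (stage_of_winner_eq_none hw)]
        exact mul_le_mul_right (ih _ _) _
  · refine Contest.expReward_le_of_rewardUpTo_le _ γ _ fun j => ?_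
    clear hlin
    induction j generalizing s τ with
    | zero => simp [Contest.rewardUpTo]
    | succ j ih =>
      cases hw : M.winner s with
      | some w =>
        rw [hGsome s w hw, ← hEsome s w hw τ]
        exact Contest.rewardUpTo_le _ γ _ _ _ _
      | none =>
        rw [Contest.expReward_eq, Contest.rewardUpTo, arrive_of_none hw, liftProfile_nil hw,
          hc s hw, hdnone s hw]
        refine add_le_add le_rfl (Finset.sum_le_sum fun b _ => ?_)
        rw [moveProb_fight hk hw, liftProfile_tail hw,
          Contest.step_of_battle _ (stage_fight n s),
          Contest.step_of_battle _ (stage_of_winner_eq_none hw)]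
        exact mul_le_mul_right (ih _ _) _

theorem victoryProb_lift (hk : k ≠ 0) (ℓ : Player) (s : S) (τ : Profile) :
    (M.iterated q N).victoryProb γ ℓ (M.arrive n true s) (M.liftProfile q N n σ k s τ) =
      ∑ w : Bool, M.standalone.victoryProb γ w s τ *
        (M.iterated q N).victoryProb γ ℓ (.round (n + 1) w)
          ((M.iterated q N).induced σ (.round (n + 1) w)) := by
  simp only [Contest.victoryProb_eq_expReward _ _ ℓ _ (M.liftProfile q N n σ k s τ)]
  rw [expReward_lift hk (c' := fun _ _ => 0) (fun s _ x => by
    rw [Contest.winReward_of_battle _ (stage_fight n s)]) (fun _ _ _ _ => rfl)]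
  simp [Contest.victoryProb_eq_expReward, Contest.expReward]

theorem effort_lift (hk : k ≠ 0) (ℓ : Player) (s : S) (τ : Profile) :
    (M.iterated q N).effort γ ℓ (M.arrive n true s) (M.liftProfile q N n σ k s τ) =
      k * M.standalone.effort γ ℓ s τ + ∑ w : Bool, M.standalone.victoryProb γ w s τ *
        (M.iterated q N).effort γ ℓ (.round (n + 1) w)
          ((M.iterated q N).induced σ (.round (n + 1) w)) := by
  simp only [Contest.effort_eq_expReward]
  rw [expReward_lift hk (c' := fun s x => k * M.standalone.effortReward ℓ s x) (fun s hs x => by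
    rw [Contest.effortReward_of_battle _ (stage_fight n s),
      Contest.effortReward_of_battle _ (stage_of_winner_eq_none hs), ENNReal.coe_mul])
    (fun s w hs x => by
      rw [Contest.effortReward_of_won _ (stage_of_winner_eq_some hs), mul_zero])]
  congr 1
  simp only [Contest.expReward, mul_left_comm _ (k : ℝ≥0∞), ENNReal.tsum_mul_left]

/-- The payoff from lifted strategies, when a round is worth `m` to the loser of the subcontest and
`m + k` to the winner, is the payoff in the subcontest up to scale, except that play in the
subcontest that never ends is rewarded by half of the prize of the iterated contest. -/
theorem realPayoff_lift (hγ : IsSuccessFunction γ) (hq0 : 0 ≤ q) (hq1 : q ≤ 1) (hk : k ≠ 0)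
    {m : ℝ} {ℓ : Player}
    (hm : ∀ w, (M.iterated q N).realValue γ v σ ℓ (.round (n + 1) w) =
      if w = ℓ then m + k else m)
    (he : ∀ w, (M.iterated q N).effort γ ℓ (.round (n + 1) w)
      ((M.iterated q N).induced σ (.round (n + 1) w)) ≠ ⊤) {s : S} {τ : Profile}
    (hτ : M.standalone.effort γ ℓ s τ ≠ ⊤) :
    (M.iterated q N).effort γ ℓ (M.arrive n true s) (M.liftProfile q N n σ k s τ) ≠ ⊤ ∧
    (M.iterated q N).realPayoff γ v ℓ (M.arrive n true s) (M.liftProfile q N n σ k s τ) =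
      m + k * M.standalone.realPayoff γ 1 ℓ s τ + (v - (2 * m + k)) / 2 *
        (1 - (M.standalone.victoryProb γ ℓ s τ).toReal -
          (M.standalone.victoryProb γ (!ℓ) s τ).toReal) := by
  have hG := properChances_iterated (M := M) (N := N) hq0 hq1
  have hvS : ∀ w, M.standalone.victoryProb γ w s τ ≠ ⊤ := fun w =>
    Contest.victoryProb_ne_top hγ properChances_standalone w s τ
  have hvG : ∀ ℓ w, (M.iterated q N).victoryProb γ ℓ (.round (n + 1) w)
      ((M.iterated q N).induced σ (.round (n + 1) w)) ≠ ⊤ := fun ℓ w =>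
    Contest.victoryProb_ne_top hγ hG ℓ _ _
  have h1 : (k : ℝ≥0∞) * M.standalone.effort γ ℓ s τ ≠ ⊤ :=
    ENNReal.mul_ne_top ENNReal.coe_ne_top hτ
  have h2 : ∑ w : Bool, M.standalone.victoryProb γ w s τ *
      (M.iterated q N).effort γ ℓ (.round (n + 1) w)
        ((M.iterated q N).induced σ (.round (n + 1) w)) ≠ ⊤ :=
    ENNReal.sum_ne_top.2 fun w _ => ENNReal.mul_ne_top (hvS w) (he w)
  refine ⟨by rw [effort_lift hk]; exact ENNReal.add_ne_top.2 ⟨h1, h2⟩, ?_⟩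
  have hm1 := hm ℓ
  have hm2 := hm (!ℓ)
  have hsum : ∀ (p X : Bool → ℝ), ∑ b : Bool, p b * X b = p ℓ * X ℓ + p (!ℓ) * X (!ℓ) := by
    intro p X
    cases ℓ <;> simp [add_comm]
  rw [if_pos rfl] at hm1
  rw [if_neg (by simp)] at hm2
  simp only [Contest.realValue, Contest.realPayoff] at hm1 hm2 ⊢
  rw [effort_lift hk, victoryProb_lift hk, victoryProb_lift hk, ENNReal.toReal_add h1 h2,
    ENNReal.toReal_mul, ENNReal.coe_toReal, Contest.toReal_sum_bool hvS (hvG ℓ),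
    Contest.toReal_sum_bool hvS (hvG !ℓ), Contest.toReal_sum_bool hvS he, hsum, hsum, hsum]
  linear_combination (M.standalone.victoryProb γ ℓ s τ).toReal * hm1 +
    (M.standalone.victoryProb γ (!ℓ) s τ).toReal * hm2

/-! ### Equilibria of the iterated contest, restricted to a round -/

/-- In round `n + 1` the players fight for the difference between the values of the incumbent and
of the challenger. If it is positive, then they play, up to scale, an equilibrium of the standalone
subcontest. A deviation in the standalone contest that keeps play from ending would pay at least as
much, up to scale, in the iterated contest. -/
theorem exists_standalone_equilibrium [Finite S] (hγ : IsSuccessFunction γ) (hM : M.CanAlwaysEnd)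
    (hq0 : 0 ≤ q) (hq1 : q ≤ 1) (hv : 0 < v) (hσ : (M.iterated q N).IsEquilibrium γ v σ)
    (hn : n < N)
    (hpos : (M.iterated q N).realValue γ v σ false (.round (n + 2) true) <
      (M.iterated q N).realValue γ v σ true (.round (n + 2) true)) :
    ∃ σ' : MarkovProfile S, M.standalone.IsEquilibrium γ 1 σ' ∧
      ∀ ℓ s, M.standalone.Reachable s →
        (M.iterated q N).realValue γ v σ ℓ (M.arrive (n + 1) true s) =
          (M.iterated q N).realValue γ v σ false (.round (n + 2) true) +
          ((M.iterated q N).realValue γ v σ true (.round (n + 2) true) -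
            (M.iterated q N).realValue γ v σ false (.round (n + 2) true)) *
            M.standalone.realValue γ 1 σ' ℓ s := by
  have hG := properChances_iterated (M := M) (N := N) hq0 hq1
  set G := M.iterated q N with hGdef
  set P := G.realValue γ v σ true (.round (n + 2) true) with hP
  set m := G.realValue γ v σ false (.round (n + 2) true) with hm
  set k : ℝ≥0 := (P - m).toNNReal with hkdef
  have hkc : (k : ℝ) = P - m := Real.coe_toNNReal _ (by linarith)
  have hk : k ≠ 0 := by
    intro h0
    rw [h0, NNReal.coe_zero] at hkc
    linarith
  have hsurplus : 2 * m + k ≤ v := by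
    rw [hkc]
    have h1 : 0 ≤ (G.effort γ true (.round (n + 2) true)
      (G.induced σ (.round (n + 2) true))).toReal := ENNReal.toReal_nonneg
    have h2 : 0 ≤ (G.effort γ false (.round (n + 2) true)
      (G.induced σ (.round (n + 2) true))).toReal := ENNReal.toReal_nonneg
    simp only [Contest.realValue, Contest.realPayoff, Bool.not_true, Bool.not_false] at hP hm
    linarith
  have hround : ∀ ℓ w, G.realValue γ v σ ℓ (.round (n + 1 + 1) w) =
      if w = ℓ then m + k else m := by
    intro ℓ w
    rw [hkc, realValue_round hσ.2]
    split_ifs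
    · rw [← hP]
      ring
    · rfl
  have hreffort : ∀ ℓ w, G.effort γ ℓ (.round (n + 1 + 1) w)
      (G.induced σ (.round (n + 1 + 1) w)) ≠ ⊤ := fun ℓ w =>
    hσ.1.effort_ne_top (reachable_round w hn) ℓ
  set σ' : MarkovProfile S := fun ℓ s => σ ℓ (.fight (n + 1) true s) / k with hσ'
  have hlift : ∀ s, M.liftProfile q N (n + 1) σ k s (M.standalone.induced σ' s) =
      G.induced σ (M.arrive (n + 1) true s) := fun s =>
    funext fun ℓ => liftStrategy_induced hk ℓ s
  have heffort : ∀ ℓ s, M.standalone.Reachable s →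
      M.standalone.effort γ ℓ s (M.standalone.induced σ' s) ≠ ⊤ := by
    intro ℓ s hs htop
    have h1 := hσ.1.effort_ne_top (reachable_arrive hn hs) ℓ
    rw [← hlift s, effort_lift hk, htop, ENNReal.mul_top (by exact_mod_cast hk), top_add] at h1
    exact h1 rfl
  -- Play ends almost surely, since both players win every battle with positive probability.
  have hends : ∀ s, M.standalone.Reachable s →
      1 - (M.standalone.victoryProb γ true s (M.standalone.induced σ' s)).toReal -
        (M.standalone.victoryProb γ false s (M.standalone.induced σ' s)).toReal ≤ 0 := by
    intro s hs
    refine hM.le_of_terminal_le (f := fun s =>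
      1 - (M.standalone.victoryProb γ true s (M.standalone.induced σ' s)).toReal -
        (M.standalone.victoryProb γ false s (M.standalone.induced σ' s)).toReal)
      (fun t ht hw => ?_) (fun t w ht hw => ?_) hs
    · have hreach : G.Reachable (.fight (n + 1) true t) := by
        have := reachable_arrive (q := q) hn ht
        rwa [arrive_of_none hw] at this
      have hp := (hσ.1.battleValues hγ hG hv.le hreach (stage_fight (n + 1) t)).2
      have hpk : ∀ ℓ, battleProb γ (σ ℓ (.fight (n + 1) true t))
          (σ (!ℓ) (.fight (n + 1) true t)) = battleProb γ (σ' ℓ t) (σ' (!ℓ) t) := by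
        intro ℓ
        rw [← battleProb_mul_mul γ hk (σ' ℓ t), hσ', mul_div_cancel₀ _ hk,
          mul_div_cancel₀ _ hk]
      have hpT := hp true
      have hpF := hp false
      rw [hpk] at hpT hpF
      simp only [Bool.not_true, Bool.not_false] at hpT hpF
      have hadd := battleProb_add hγ (σ' true t) (σ' false t)
      refine ⟨_, hpT, by linarith, le_of_eq ?_⟩
      have hvS : ∀ ℓ b, M.standalone.victoryProb γ ℓ (M.standalone.step t b)
          ((M.standalone.induced σ' t).tail b) ≠ ⊤ := fun ℓ b =>
        Contest.victoryProb_ne_top hγ properChances_standalone ℓ _ _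
      have hvic : ∀ ℓ, (M.standalone.victoryProb γ ℓ t (M.standalone.induced σ' t)).toReal =
          battleProb γ (σ' true t) (σ' false t) * (M.standalone.victoryProb γ ℓ (M.next t true)
            (M.standalone.induced σ' (M.next t true))).toReal +
          battleProb γ (σ' false t) (σ' true t) * (M.standalone.victoryProb γ ℓ (M.next t false)
            (M.standalone.induced σ' (M.next t false))).toReal := by
        intro ℓ
        rw [Contest.victoryProb_step (by simp [stage_of_winner_eq_none hw]),
          Contest.toReal_sum_bool (fun b => Contest.moveProb_ne_top _ _ _) (hvS ℓ)]
        simp only [Fintype.sum_bool, Contest.moveProb_of_battle _ γ (stage_of_winner_eq_none hw),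
          ENNReal.toReal_ofReal (battleProb_nonneg hγ _ _), Contest.induced_tail,
          Contest.step_of_battle _ (stage_of_winner_eq_none hw), Contest.induced_nil,
          Bool.not_true, Bool.not_false]
      rw [hvic, hvic, ← eq_sub_of_add_eq' hadd]
      linear_combination -hadd
    · simp only [Contest.victoryProb_of_won (stage_of_winner_eq_some hw)]
      cases w <;> simp
  have hends' : ∀ ℓ s, M.standalone.Reachable s →
      1 - (M.standalone.victoryProb γ ℓ s (M.standalone.induced σ' s)).toReal -
        (M.standalone.victoryProb γ (!ℓ) s (M.standalone.induced σ' s)).toReal = 0 := by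
    intro ℓ s hs
    have h1 := hends s hs
    have h2 := ENNReal.toReal_mono ENNReal.one_ne_top (Contest.victoryProb_add_le_one hγ
      (properChances_standalone (M := M)) s (M.standalone.induced σ' s) true)
    rw [ENNReal.toReal_add (Contest.victoryProb_ne_top hγ properChances_standalone _ _ _)
      (Contest.victoryProb_ne_top hγ properChances_standalone _ _ _), ENNReal.toReal_one] at h2
    simp only [Bool.not_true] at h2
    cases ℓ <;> simp only [Bool.not_true, Bool.not_false] <;> linarith
  have hvalue : ∀ ℓ s, M.standalone.Reachable s →
      G.realValue γ v σ ℓ (M.arrive (n + 1) true s) =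
        m + k * M.standalone.realValue γ 1 σ' ℓ s := by
    intro ℓ s hs
    have h1 := (realPayoff_lift hγ hq0 hq1 hk (hround ℓ) (hreffort ℓ) (heffort ℓ s hs)).2
    rw [hends' ℓ s hs, mul_zero, add_zero, hlift] at h1
    exact h1
  refine ⟨σ', ⟨?_, ?_⟩, fun ℓ s hs => by rw [hvalue ℓ s hs, hkc]⟩
  · intro h ℓ τ
    have hs : M.standalone.Reachable (M.standalone.run M.standalone.init h) := ⟨h, rfl⟩
    generalize M.standalone.run M.standalone.init h = s at hs
    by_cases htop : M.standalone.effort γ ℓ s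
        (Function.update (M.standalone.induced σ' s) ℓ τ) = ⊤
    · rw [Contest.payoff_of_effort_eq_top htop]
      exact bot_le
    · rw [Contest.value, Contest.payoff_eq_coe hγ properChances_standalone zero_le_one htop,
        Contest.payoff_eq_coe hγ properChances_standalone zero_le_one (heffort ℓ s hs),
        EReal.coe_le_coe_iff]
      obtain ⟨h1, h2⟩ := realPayoff_lift hγ hq0 hq1 hk (hround ℓ) (hreffort ℓ) htop
      have hupd : M.liftProfile q N (n + 1) σ k s
          (Function.update (M.standalone.induced σ' s) ℓ τ) =
          Function.update (G.induced σ (M.arrive (n + 1) true s)) ℓ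
            (M.liftStrategy q N (n + 1) σ k ℓ s τ) := by
        rw [← hlift s]
        funext ℓ'
        by_cases hℓ : ℓ' = ℓ
        · subst hℓ
          simp [liftProfile]
        · simp [liftProfile, hℓ]
      have h3 : G.payoff γ v ℓ (M.arrive (n + 1) true s)
          (Function.update (G.induced σ (M.arrive (n + 1) true s)) ℓ
            (M.liftStrategy q N (n + 1) σ k ℓ s τ)) ≤
          G.value γ v σ ℓ (M.arrive (n + 1) true s) := by
        obtain ⟨g, hg⟩ := reachable_arrive (q := q) hn hs
        rw [hg]
        exact hσ.1 g ℓ _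
      rw [← hupd, Contest.payoff_eq_coe hγ hG hv.le h1,
        hσ.1.value_eq_coe hγ hG hv.le (reachable_arrive hn hs), EReal.coe_le_coe_iff, h2,
        hvalue ℓ s hs] at h3
      have h4 := Contest.victoryProb_add_le_one hγ (properChances_standalone (M := M)) s
        (Function.update (M.standalone.induced σ' s) ℓ τ) ℓ
      have h5 := ENNReal.toReal_mono ENNReal.one_ne_top h4
      rw [ENNReal.toReal_add (Contest.victoryProb_ne_top hγ properChances_standalone _ _ _)
        (Contest.victoryProb_ne_top hγ properChances_standalone _ _ _),
        ENNReal.toReal_one] at h5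
      have h6 : 0 ≤ (v - (2 * m + k)) / 2 *
          (1 - (M.standalone.victoryProb γ ℓ s
            (Function.update (M.standalone.induced σ' s) ℓ τ)).toReal -
          (M.standalone.victoryProb γ (!ℓ) s
            (Function.update (M.standalone.induced σ' s) ℓ τ)).toReal) :=
        mul_nonneg (by linarith) (by linarith)
      have h7 : (0 : ℝ) < k := by positivity
      refine le_of_mul_le_mul_left ?_ h7
      change _ ≤ k * M.standalone.realValue γ 1 σ' ℓ s
      linarith
  · intro R hR s s' h hb ℓ
    have hw : M.winner s = none := by
      obtain ⟨next, hb⟩ := hb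
      cases hw : M.winner s with
      | none => rfl
      | some w => simp [stage_of_winner_eq_some hw] at hb
    simp only [hσ']
    rw [hσ.2 _ (isMirror_iterMirror hR) _ _ (.within (n + 1) true s s' h hw)
      ⟨_, stage_fight (n + 1) s⟩ ℓ]

end Subcontest

/-! ### Full dissipation -/

namespace Contest

variable {S : Type*} {G : Contest S} {γ : ℝ → ℝ}

/-- The part of the prize that is not dissipated is what the players expect at the beginning. -/
theorem IsMPE.lt_totalEffort {v : ℝ}
    {σ : MarkovProfile S} (hσ : G.IsMPE γ v σ) {B : ℝ}
    (hB : B < v - (G.realValue γ v σ true G.init + G.realValue γ v σ false G.init)) :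
    (B : EReal) < (G.totalEffort γ σ : EReal) := by
  have h1 := hσ.effort_ne_top reachable_init true
  have h2 := hσ.effort_ne_top reachable_init false
  rw [totalEffort, ← EReal.coe_ennreal_toReal (ENNReal.add_ne_top.2 ⟨h1, h2⟩),
    ENNReal.toReal_add h1 h2, EReal.coe_lt_coe_iff]
  simp only [realValue, realPayoff, Bool.not_true, Bool.not_false] at hB
  linarith

/-- Transient dominance holds if and only if it holds for the largest admissible sets, which consist
of all non-terminal histories after which the value of `ℓ` is at most `ε * v`. If both players
expect at most `ε * v` at the beginning, then the initial history belongs to both sets. -/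
theorem IsMPE.transientDominance (hγ : IsSuccessFunction γ) (hG : G.ProperChances) {v : ℝ}
    (hv : 0 ≤ v) {σ : MarkovProfile S} (hσ : G.IsMPE γ v σ) {ε : ℝ} (hε : 0 < ε)
    (hinit : ∀ k, G.stage G.init ≠ .won k)
    (h : ∀ ℓ, G.realValue γ v σ ℓ G.init ≤ ε * v) : G.TransientDominance γ v σ ε := by
  refine ⟨fun ℓ => {h | (∀ k, G.stage (G.run G.init h) ≠ .won k) ∧
    G.value γ v σ ℓ (G.run G.init h) ≤ ((ε * v : ℝ) : EReal)}, fun ℓ h hh => hh, ?_⟩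
  have hmem : ∀ ℓ, [] ∈ {h | (∀ k, G.stage (G.run G.init h) ≠ .won k) ∧
      G.value γ v σ ℓ (G.run G.init h) ≤ ((ε * v : ℝ) : EReal)} := by
    intro ℓ
    refine ⟨hinit, ?_⟩
    rw [run_nil, hσ.value_eq_coe hγ hG hv reachable_init]
    exact_mod_cast h ℓ
  refine le_trans ?_ (ENNReal.le_tsum ([] : List Bool))
  rw [if_pos ⟨fun ℓ => ⟨[], List.prefix_rfl, hmem ℓ⟩, fun g hg hne =>
    absurd (List.prefix_nil.1 hg) hne⟩, pathProb, ← ENNReal.ofReal_one]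
  exact ENNReal.ofReal_le_ofReal (by linarith)

end Contest

namespace Subcontest

variable {S : Type*} {M : Subcontest S} {γ : ℝ → ℝ} {q v : ℝ} {N n : ℕ}

/-- The players' joint value at the beginning of a round does not exceed the one at the beginning
of the next round. -/
theorem surplus_round_le [Finite S] (hγ : IsSuccessFunction γ) (hM : M.CanAlwaysEnd)
    (hq0 : 0 ≤ q) (hq1 : q ≤ 1) (hv : 0 < v) {σ : MarkovProfile (IterState S)}
    (hσ : (M.iterated q N).IsEquilibrium γ v σ) (hn : n < N) :
    (M.iterated q N).realValue γ v σ true (.round (n + 1) true) +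
      (M.iterated q N).realValue γ v σ false (.round (n + 1) true) ≤
    (M.iterated q N).realValue γ v σ true (.round (n + 2) true) +
      (M.iterated q N).realValue γ v σ false (.round (n + 2) true) := by
  have hG := properChances_iterated (M := M) (N := N) hq0 hq1
  have harrive : (M.iterated q N).realValue γ v σ true (M.arrive (n + 1) true M.init) +
      (M.iterated q N).realValue γ v σ false (M.arrive (n + 1) true M.init) ≤
      (M.iterated q N).realValue γ v σ true (.round (n + 2) true) +
        (M.iterated q N).realValue γ v σ false (.round (n + 2) true) := by
    refine hM.le_of_terminal_le (f := fun s =>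
      (M.iterated q N).realValue γ v σ true (M.arrive (n + 1) true s) +
      (M.iterated q N).realValue γ v σ false (M.arrive (n + 1) true s))
      (fun t ht hw => ?_) (fun t w ht hw => ?_) (Contest.reachable_init (G := M.standalone))
    · have hreach : (M.iterated q N).Reachable (.fight (n + 1) true t) := by
        have := reachable_arrive (q := q) hn ht
        rwa [arrive_of_none hw] at this
      obtain ⟨p, hp0, hp1, hp⟩ := (hσ.1.battleValues hγ hG hv.le hreach
        (stage_fight (n + 1) t)).1.exists_le_average hγ
      refine ⟨p, hp0, hp1, ?_⟩
      rw [arrive_of_none hw]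
      linarith [hp true, hp false]
    · simp only [arrive_true_of_some hw]
      rw [realValue_round hσ.2, realValue_round hσ.2 (n + 1 + 1) w false,
        show n + 1 + 1 = n + 2 from rfl]
      cases w <;> simp only [if_true, if_false, reduceCtorEq] <;> linarith
  have hreach : (M.iterated q N).Reachable (.round (n + 1) true) := reachable_round true hn.le
  rw [hσ.1.realValue_of_chance hγ hG hreach (stage_round hn true),
    hσ.1.realValue_of_chance hγ hG hreach (stage_round hn true)]
  simp only [if_true, Bool.false_eq_true, if_false]
  rw [show n + 1 + 1 = n + 2 from rfl]
  nlinarith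

/-- Backward induction over the rounds, where `j` rounds remain. Either the joint value has fallen
to `2 * ε * v` already; or incumbency still has a positive value, which has shrunk geometrically,
and the bias of the subcontest has accumulated: the value of the challenger is at most the
fraction `ε` of the loss of the incumbent. -/
theorem round_values [Finite S] (hγ : IsSuccessFunction γ) (hM : M.CanAlwaysEnd)
    (hq0 : 0 < q) (hq1 : q ≤ 1) (hv : 0 < v) {ε : ℝ} (hε : 0 < ε)
    (hbias : M.SufficientlyBiased γ ε) {c : ℝ}
    (hc : ∀ V, M.IsValueSystem γ V → 0 < V false M.init → c ≤ 1 - V true M.init)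
    {σ : MarkovProfile (IterState S)} (hσ : (M.iterated q N).IsEquilibrium γ v σ) (j : ℕ)
    (hj : j ≤ N) :
    (M.iterated q N).realValue γ v σ true (.round (N - j + 1) true) +
      (M.iterated q N).realValue γ v σ false (.round (N - j + 1) true) ≤ 2 * (ε * v) ∨
    ((M.iterated q N).realValue γ v σ false (.round (N - j + 1) true) <
        (M.iterated q N).realValue γ v σ true (.round (N - j + 1) true) ∧
      (M.iterated q N).realValue γ v σ false (.round (N - j + 1) true) ≤
        ε * (v - (M.iterated q N).realValue γ v σ true (.round (N - j + 1) true)) ∧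
      (M.iterated q N).realValue γ v σ true (.round (N - j + 1) true) -
        (M.iterated q N).realValue γ v σ false (.round (N - j + 1) true) ≤
        (1 - q * c) ^ j * v) := by
  have hG := properChances_iterated (M := M) (N := N) hq0.le hq1
  induction j with
  | zero =>
    right
    have hst := stage_round_of_lt (M := M) (q := q) (Nat.lt_succ_self N) true
    rw [Nat.sub_zero, Contest.realValue_of_won hst, Contest.realValue_of_won hst]
    simp [hv]
  | succ j ih =>
    obtain ⟨n, hn⟩ : ∃ n, N = n + (j + 1) := ⟨N - (j + 1), by omega⟩
    have hnN : n < N := by omega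
    have ih := ih (by omega)
    rw [show N - j + 1 = n + 2 by omega] at ih
    rw [show N - (j + 1) + 1 = n + 1 by omega]
    have hsur := surplus_round_le hγ hM hq0.le hq1 hv hσ hnN
    rcases ih with ih | ⟨hpos, hineq, hgeo⟩
    · exact Or.inl (hsur.trans ih)
    obtain ⟨σ', hσ', hval⟩ := exists_standalone_equilibrium hγ hM hq0.le hq1 hv hσ hnN hpos
    have hV := isValueSystem_of_isMPE hγ hσ'.1
    have hinit : M.standalone.Reachable M.init := Contest.reachable_init (G := M.standalone)
    have hb := hbias σ' hσ'
    rw [hσ'.1.value_eq_coe hγ properChances_standalone zero_le_one hinit,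
      hσ'.1.value_eq_coe hγ properChances_standalone zero_le_one hinit, EReal.toReal_coe,
      EReal.toReal_coe] at hb
    have hU0 := hV.nonneg _ hinit false
    have hcU := hc _ hV
    have hvT := hval true M.init hinit
    have hvF := hval false M.init hinit
    have hreach : (M.iterated q N).Reachable (.round (n + 1) true) :=
      reachable_round true hnN.le
    have hchT := hσ.1.realValue_of_chance hγ hG hreach (stage_round hnN true) true
    have hchF := hσ.1.realValue_of_chance hγ hG hreach (stage_round hnN true) false
    simp only [if_true, Bool.false_eq_true, if_false] at hchT hchF
    rw [show n + 1 + 1 = n + 2 from rfl, hvT] at hchT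
    rw [show n + 1 + 1 = n + 2 from rfl, hvF] at hchF
    have hnnT := hσ.1.realValue_nonneg hγ hG hv.le hreach true
    generalize (M.iterated q N).realValue γ v σ true (.round (n + 1) true) = A at *
    generalize (M.iterated q N).realValue γ v σ false (.round (n + 1) true) = B at *
    generalize (M.iterated q N).realValue γ v σ true (.round (n + 2) true) = P at *
    generalize (M.iterated q N).realValue γ v σ false (.round (n + 2) true) = m at *
    generalize M.standalone.realValue γ 1 σ' true M.init = U at *
    generalize M.standalone.realValue γ 1 σ' false M.init = W at *
    have hW : 0 < W := by
      rcases hU0.eq_or_lt with h | h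
      · rw [← h, div_zero] at hb
        exact absurd hb (not_lt.2 (by positivity))
      · exact h
    have hbias' : W ≤ ε * (1 - U) := by
      rw [gt_iff_lt, div_lt_div_iff₀ hε hW] at hb
      linarith
    have hcU := hcU hW
    have hD : 0 < P - m := by linarith
    have hqD : 0 < q * (P - m) := mul_pos hq0 hD
    have hineq' : B ≤ ε * (v - A) := by
      have h1 := mul_le_mul_of_nonneg_left hbias' hqD.le
      rw [hchT, hchF]
      linarith
    rcases le_or_gt A B with hAB | hAB
    · left
      have h1 : 0 ≤ ε * A := by positivity
      linarith
    · refine Or.inr ⟨hAB, hineq', ?_⟩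
      have hfac : A - B = (P - m) * (1 - q * (1 - U + W)) := by
        rw [hchT, hchF]
        ring
      have h1 : q * c ≤ q * (1 - U + W) := mul_le_mul_of_nonneg_left (by linarith) hq0.le
      have h2 : 0 < 1 - q * (1 - U + W) := by
        have h3 : 0 < A - B := by linarith
        rw [hfac] at h3
        exact pos_of_mul_pos_right h3 hD.le
      calc A - B ≤ (P - m) * (1 - q * c) := by
            rw [hfac]
            exact mul_le_mul_of_nonneg_left (by linarith) hD.le
        _ ≤ ((1 - q * c) ^ j * v) * (1 - q * c) :=
            mul_le_mul_of_nonneg_right hgeo (by linarith)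
        _ = (1 - q * c) ^ (j + 1) * v := by ring

/-- With sufficiently many rounds the players' joint value at the beginning is at most
`2 * ε * v`. -/
theorem exists_surplus_bound [Finite S] (hγ : IsSuccessFunction γ) (hM : M.CanAlwaysEnd)
    (hq0 : 0 < q) (hq1 : q ≤ 1) {ε : ℝ} (hε : 0 < ε) (hbias : M.SufficientlyBiased γ ε) :
    ∃ N₀ : ℕ, ∀ N, N₀ ≤ N → ∀ v, 0 < v → ∀ σ : MarkovProfile (IterState S),
      (M.iterated q N).IsEquilibrium γ v σ →
      (M.iterated q N).realValue γ v σ true (.round 1 true) +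
        (M.iterated q N).realValue γ v σ false (.round 1 true) ≤ 2 * (ε * v) := by
  obtain ⟨c, hc0, hc1, hc⟩ := exists_loss_bound hγ hM
  have hqc : 0 < q * c := mul_pos hq0 hc0
  have hqc1 : q * c ≤ 1 := mul_le_one₀ hq1 hc0.le hc1
  obtain ⟨N₀, hN₀⟩ := exists_pow_lt_of_lt_one (pow_pos hε 2) (by linarith : 1 - q * c < 1)
  refine ⟨N₀, fun N hN v hv σ hσ => ?_⟩
  have h := round_values hγ hM hq0 hq1 hv hε hbias hc hσ N le_rfl
  rw [Nat.sub_self, zero_add] at h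
  rcases h with h | ⟨-, h1, h2⟩
  · exact h
  · have h3 : (1 - q * c) ^ N ≤ ε ^ 2 :=
      (pow_le_pow_of_le_one (by linarith) (by linarith) hN).trans hN₀.le
    have h4 := mul_le_mul_of_nonneg_right h3 hv.le
    have hreach : (M.iterated q N).Reachable (.round 1 true) :=
      reachable_round true (Nat.zero_le N)
    have h5 := hσ.1.realValue_nonneg hγ (properChances_iterated hq0.le hq1) hv.le hreach true
    generalize (M.iterated q N).realValue γ v σ true (.round 1 true) = A at *
    generalize (M.iterated q N).realValue γ v σ false (.round 1 true) = B at *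
    -- The value of the incumbent is below `ε * v`, as it exceeds the value of the challenger,
    -- which is below `ε * (v - A)`, by at most `ε ^ 2 * v`.
    have h6 : A ≤ ε * v := by
      have h7 : (1 + ε) * A ≤ (1 + ε) * (ε * v) := by nlinarith
      exact le_of_mul_le_mul_left h7 (by linarith)
    have h8 : 0 ≤ ε * A := by positivity
    linarith

theorem realValue_toss (hγ : IsSuccessFunction γ) (hq0 : 0 ≤ q) (hq1 : q ≤ 1)
    {σ : MarkovProfile (IterState S)} (hσ : (M.iterated q N).IsEquilibrium γ v σ) (ℓ : Player) :
    (M.iterated q N).realValue γ v σ ℓ (M.iterated q N).init =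
      ((M.iterated q N).realValue γ v σ true (.round 1 true) +
        (M.iterated q N).realValue γ v σ false (.round 1 true)) / 2 := by
  rw [hσ.1.realValue_of_chance hγ (properChances_iterated hq0 hq1) Contest.reachable_init
    stage_toss, realValue_round hσ.2, realValue_round hσ.2 1 false]
  cases ℓ <;> simp <;> ring

end Subcontest

theorem mainTheorem6 (γ : ℝ → ℝ) (hγ : IsSuccessFunction γ) :
    (∀ (S : Type) (_ : Finite S) (M : Subcontest S) (q ε : ℝ),
      M.CanAlwaysEnd → 0 < q → q ≤ 1 → 0 < ε → M.SufficientlyBiased γ ε →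
      ∃ N₀ : ℕ, ∀ N : ℕ, N₀ ≤ N → ∀ v : ℝ, 0 < v →
        ∀ σ : MarkovProfile (IterState S), (M.iterated q N).IsEquilibrium γ v σ →
          (M.iterated q N).TransientDominance γ v σ ε ∧
          (((1 - 4 * ε) * v : ℝ) : EReal) < ((M.iterated q N).totalEffort γ σ : EReal)) ∧
    (∀ ε : ℝ, 0 < ε → ∃ K₀ : ℕ, ∀ K : ℕ, K₀ ≤ K →
      (oneWinRace K).CanAlwaysEnd ∧ (oneWinRace K).SufficientlyBiased γ ε ∧
      (headStartTugOfWar K).CanAlwaysEnd ∧ (headStartTugOfWar K).SufficientlyBiased γ ε) := by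
  constructor
  · intro S _ M q ε hM hq0 hq1 hε hbias
    obtain ⟨N₀, hN₀⟩ := Subcontest.exists_surplus_bound hγ hM hq0 hq1 hε hbias
    refine ⟨N₀, fun N hN v hv σ hσ => ?_⟩
    have h := hN₀ N hN v hv σ hσ
    have hG := Subcontest.properChances_iterated (M := M) (N := N) hq0.le hq1
    have htoss := Subcontest.realValue_toss hγ hq0.le hq1 hσ
    refine ⟨hσ.1.transientDominance hγ hG hv.le hε (fun k => ?_) fun ℓ => ?_,
      hσ.1.lt_totalEffort ?_⟩
    · simp [Subcontest.iterated]
    · rw [htoss]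
      linarith
    · rw [htoss, htoss]
      have : 0 < ε * v := mul_pos hε hv
      linarith
  · intro ε _
    obtain ⟨K₁, hK₁⟩ := oneWinRace_sufficientlyBiased hγ ε
    obtain ⟨K₂, hK₂⟩ := headStartTugOfWar_sufficientlyBiased hγ ε
    exact ⟨max K₁ K₂, fun K hK => ⟨oneWinRace_canAlwaysEnd K,
      hK₁ K ((le_max_left _ _).trans hK), headStartTugOfWar_canAlwaysEnd K,
      hK₂ K ((le_max_right _ _).trans hK)⟩⟩
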